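/- Let $0<d^-\le d^+<\infty$ and put $\theta=\min\{d^-,1\}$. There exists a positive constant $c=c(d^+,d^-)$, depending only on $d^+$ and $d^-$, such that the following holds. Let $(d_k)_{k\ge 1}$ be any sequence of real numbers with $d^-\le d_k\le d^+$ for all $k\ge 1$, and let $(p_j)_{j\ge 0}$ be the Taylor coefficients at $0$ of $$p(z)=\exp\Bigl\{\sum_{k=1}^{\infty}\frac{d_k}{k}z^k\Bigr\}=\sum_{j=0}^{\infty}p_jz^j,\qquad |z|<1 .$$ Then all $p_j$ are positive real numbers. For every function $g(z)=\sum_{k=0}^{\infty}a_kz^k$ with complex coefficients $a_k$ that is analytic in the disc $|z|<1$, write $$S(g;j)=\sum_{k=0}^{j}k\,a_k\,p_{j-k}\qquad (j\ge 0).$$ Then for every integer $n\ge 1$ the series $\sum_{j>n}\frac{|S(g;j)|}{j}e^{-j/n}$ converges, and $$\left|\frac{1}{p_n}\sum_{k=0}^{n}a_kp_{n-k}-g(e^{-1/n})-\frac{S(g;n)}{n\,p_n}\right|\le c\left(\frac{1}{n^{\theta}}\sum_{j=1}^{n}\frac{|S(g;j)|}{p_j}\,j^{\theta-2}+\frac{1}{p(e^{-1/n})}\sum_{j>n}\frac{|S(g;j)|}{j}\,e^{-j/n}\right).$$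 -/

import Mathlib

namespace Voronoi

/-- The function `p(z) = exp (∑_{k ≥ 1} (d_k / k) z ^ k)` (only used for `‖z‖ < 1`;
the value `d 0` plays no role). -/
noncomputable def genFun (d : ℕ → ℝ) (z : ℂ) : ℂ :=
  Complex.exp (∑' k : ℕ, ((d (k + 1) : ℂ) / ((k : ℂ) + 1)) * z ^ (k + 1))

/-- The `j`-th Taylor coefficient `p_j` of `genFun d` at the origin. It is a real number, and
`re` only records it as an element of `ℝ`. -/
noncomputable def genCoeff (d : ℕ → ℝ) (j : ℕ) : ℝ :=
  (iteratedDeriv j (genFun d) 0 / (j.factorial : ℂ)).re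

/-- `S(g; j) = ∑_{k=0}^{j} a_k k p_{j-k}`, where `a` is the sequence of Taylor coefficients
of `g`. -/
noncomputable def S (p : ℕ → ℝ) (a : ℕ → ℂ) (j : ℕ) : ℂ :=
  ∑ k ∈ Finset.range (j + 1), a k * (k : ℂ) * (p (j - k) : ℂ)

/-- The Voronoi mean `(1 / p_n) ∑_{k=0}^{n} a_k p_{n-k}`. -/
noncomputable def mean (p : ℕ → ℝ) (a : ℕ → ℂ) (n : ℕ) : ℂ :=
  (1 / (p n : ℂ)) * ∑ k ∈ Finset.range (n + 1), a k * (p (n - k) : ℂ)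

end Voronoi

namespace Voronoi

open Filter Topology Finset

/-! The numbers `S(g; j)` are the coefficients of `z g'(z) p(z)`, so dividing by `p` recovers `g'`,
and both the mean and `g(r)`, `r = e^{-1/n}`, are linear in them. With `1/k = ∫_0^1 x^(k-1) dx` one
gets `g(r) - a_0 = ∑_{j ≥ 1} S(g; j) ∫_0^r x^(j-1) / p(x) dx` (`hasSum_S_mul_recipInt`), `∑_{k ≤ n}
a_k p_{n-k} - a_0 p_n = ∑_{1 ≤ j ≤ n} S(g; j) ∫_0^1 x^(j-1) h_{n-j}(x) dx` (`sum_mul_genCoeff_eq`),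
where `h_N(x)` is the coefficient of `z^N` in `p(z) / p(xz)`. As `h_0 = 1`, the second integral for
`j = n` is `1/n`, which accounts for the term `S(g; n) / (n p_n)`. What remains is a bound on the
weight of each `S(g; j)`. For `j > n` only the first integral is present (`recipInt_le_of_le`). For
`j < n` the two integrals, the second divided by `p_n`, must nearly cancel
(`exists_abs_meanInt_sub_le`).

The cancellation says that `h_{n-j}(x)` is close to `p_n / p(x)` for `8j ≤ n` and `x ≤ r`
(`exists_abs_genCoeff_sub_le`). Indeed `p_n = ∑_m p_m x^m h_{n-m}(x)`, while `p(x) h_{n-j}(x) = ∑_m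
p_m x^m h_{n-j}(x)`, so it is enough that `h_N` varies slowly for `N` near `n`. To see this, split
off `((1 - xz) / (1 - z))^θ` from `p(z) / p(xz)`. Since `θ ≤ 1`, its coefficients `A_m` decrease,
while `m A_m` increases; hence they have small lagged differences. Since `θ ≤ d_k`, the cofactor has
nonnegative coefficients, and convolution with it preserves the smoothness
(`abs_genCoeff_defl_sub_le`). These two demands are the reason for `θ = min(d^-, 1)`.

Sizes are measured by comparing `p` with powers of `1 / (1 - x)` (`genReal_le_mul_rpow`,
`mul_rpow_le_genReal`), and `n p_n` with `p(e^{-1/n})` in both directions (`mul_genCoeff_le`,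
`genReal_rad_le`). -/

/-! ### Taylor coefficients: recurrence, reality and convergence. -/

lemma hasFPowerSeriesAt_tsum {c : ℕ → ℂ} {D : ℝ} (hc : ∀ k, ‖c k‖ ≤ D) :
    HasFPowerSeriesAt (fun z : ℂ => ∑' k, c k * z ^ k)
      (FormalMultilinearSeries.ofScalars ℂ c) 0 := by
  have hr : (1 : ENNReal) ≤ (FormalMultilinearSeries.ofScalars ℂ c).radius := by
    have := (FormalMultilinearSeries.ofScalars ℂ c).le_radius_of_bound (r := 1) D (fun n => by
      simpa [FormalMultilinearSeries.ofScalars_norm] using hc n)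
    simpa using this
  have h := (FormalMultilinearSeries.ofScalars ℂ c).hasFPowerSeriesOnBall
    (lt_of_lt_of_le one_pos hr)
  convert h.hasFPowerSeriesAt using 1
  funext z
  exact (FormalMultilinearSeries.ofScalars_sum_eq c z).symm

lemma iteratedDeriv_tsum {c : ℕ → ℂ} {D : ℝ} (hc : ∀ k, ‖c k‖ ≤ D) (n : ℕ) :
    iteratedDeriv n (fun z : ℂ => ∑' k, c k * z ^ k) 0 = n.factorial * c n := by
  have h := hasFPowerSeriesAt_tsum hc
  have h2 := h.analyticAt.hasFPowerSeriesAt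
  have h3 := FormalMultilinearSeries.ofScalars_series_injective ℂ ℂ
    (h.eq_formalMultilinearSeries h2)
  have h4 := congrFun h3 n
  rw [h4, mul_div_cancel₀ _ (by exact_mod_cast Nat.factorial_ne_zero n)]

/-- `genFun e` solves a first-order linear differential equation. -/
lemma hasDerivAt_genFun {e : ℕ → ℝ} {D : ℝ} (he : ∀ k, |e (k + 1)| ≤ D) {z : ℂ} (hz : ‖z‖ < 1) :
    HasDerivAt (genFun e) ((∑' k, (e (k + 1) : ℂ) * z ^ k) * genFun e z) z := by
  obtain ⟨r, hr, hr1⟩ := exists_between hz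
  have hr0 : 0 ≤ r := (norm_nonneg z).trans hr.le
  have hnorm : ∀ k, ‖(e (k + 1) : ℂ)‖ ≤ D := fun k => by simpa using he k
  have hD : 0 ≤ D := (abs_nonneg _).trans (he 0)
  have key : HasDerivAt (fun w : ℂ => ∑' k : ℕ, ((e (k + 1) : ℂ) / ((k : ℂ) + 1)) * w ^ (k + 1))
      (∑' k, (e (k + 1) : ℂ) * z ^ k) z := by
    refine hasDerivAt_tsum_of_isPreconnected (𝕜 := ℂ) (F := ℂ)
      (g := fun (k : ℕ) w => ((e (k + 1) : ℂ) / ((k : ℂ) + 1)) * w ^ (k + 1))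
      (g' := fun k w => (e (k + 1) : ℂ) * w ^ k) (u := fun k => D * r ^ k) (t := Metric.ball (0 : ℂ) r)
      (y₀ := (0 : ℂ)) ((summable_geometric_of_lt_one hr0 hr1).mul_left D) Metric.isOpen_ball
      (convex_ball _ _).isPreconnected ?_ ?_ ?_ ?_ ?_
    · intro k y _
      have hk : (k : ℂ) + 1 ≠ 0 := by exact_mod_cast Nat.succ_ne_zero k
      have h := (hasDerivAt_pow (k + 1) y).const_mul ((e (k + 1) : ℂ) / ((k : ℂ) + 1))
      rwa [← mul_assoc, Nat.cast_succ, div_mul_cancel₀ _ hk, Nat.add_sub_cancel] at h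
    · intro k y hy
      rw [norm_mul, norm_pow]
      have : ‖y‖ ≤ r := by simpa using (Metric.mem_ball.1 hy).le
      gcongr
      exact hnorm k
    · simpa using (norm_nonneg z).trans_lt hr
    · simp
    · simpa using hr
  rw [mul_comm]
  exact key.cexp

lemma differentiableOn_genFun {e : ℕ → ℝ} {D : ℝ} (he : ∀ k, |e (k + 1)| ≤ D) :
    DifferentiableOn ℂ (genFun e) (Metric.ball 0 1) := fun z hz =>
  (hasDerivAt_genFun he (by simpa using hz)).differentiableAt.differentiableWithinAt

/-- Leibniz's rule for `p' = (∑ e_{k+1} z^k) p`. All sign and size information on the coefficients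
comes from this recurrence. -/
lemma iteratedDeriv_genFun_succ {e : ℕ → ℝ} {D : ℝ} (he : ∀ k, |e (k + 1)| ≤ D) (n : ℕ) :
    iteratedDeriv (n + 1) (genFun e) 0 / ((n + 1).factorial : ℂ) * (n + 1) =
      ∑ k ∈ range (n + 1), (e (k + 1) : ℂ) *
        (iteratedDeriv (n - k) (genFun e) 0 / ((n - k).factorial : ℂ)) := by
  have hnorm : ∀ k, ‖(e (k + 1) : ℂ)‖ ≤ D := fun k => by simpa using he k
  have hev : deriv (genFun e) =ᶠ[𝓝 0]
      ((fun z => ∑' k, (e (k + 1) : ℂ) * z ^ k) * genFun e) := by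
    filter_upwards [Metric.ball_mem_nhds (0 : ℂ) one_pos] with z hz
    exact (hasDerivAt_genFun he (by simpa using hz)).deriv
  have hA : AnalyticAt ℂ (genFun e) 0 :=
    (differentiableOn_genFun he).analyticAt (Metric.ball_mem_nhds _ one_pos)
  have hB := (hasFPowerSeriesAt_tsum hnorm).analyticAt
  rw [iteratedDeriv_succ', hev.iteratedDeriv_eq n, iteratedDeriv_mul hB.contDiffAt hA.contDiffAt,
    div_mul_eq_mul_div, Finset.sum_mul, Finset.sum_div]
  refine Finset.sum_congr rfl fun k hk => ?_
  have hkn : k ≤ n := by simpa [Nat.lt_succ_iff] using hk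
  rw [iteratedDeriv_tsum hnorm, Nat.choose_eq_factorial_div_factorial hkn,
    Nat.cast_div (Nat.factorial_mul_factorial_dvd_factorial hkn) (by
      exact_mod_cast mul_ne_zero (Nat.factorial_ne_zero k) (Nat.factorial_ne_zero (n - k))),
    Nat.factorial_succ]
  have := Nat.factorial_ne_zero n
  have := Nat.factorial_ne_zero k
  have := Nat.factorial_ne_zero (n - k)
  have : (n : ℂ) + 1 ≠ 0 := by exact_mod_cast Nat.succ_ne_zero n
  push_cast
  field_simp

lemma genFun_zero_right (e : ℕ → ℝ) : genFun e 0 = 1 := by simp [genFun]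

lemma im_iteratedDeriv_genFun {e : ℕ → ℝ} {D : ℝ} (he : ∀ k, |e (k + 1)| ≤ D) (n : ℕ) :
    (iteratedDeriv n (genFun e) 0 / (n.factorial : ℂ)).im = 0 := by
  induction n using Nat.strong_induction_on with
  | _ n ih =>
    rcases n with _ | n
    · simp [genFun_zero_right]
    · have h := congrArg Complex.im (iteratedDeriv_genFun_succ he n)
      have hz : (∑ k ∈ range (n + 1), (e (k + 1) : ℂ) *
          (iteratedDeriv (n - k) (genFun e) 0 / ((n - k).factorial : ℂ))).im = 0 := by
        rw [Complex.im_sum]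
        refine Finset.sum_eq_zero fun k _ => ?_
        rw [Complex.im_ofReal_mul, ih (n - k) (by omega), mul_zero]
      rw [hz] at h
      have h2 : ((n : ℂ) + 1) = (((n : ℝ) + 1 : ℝ) : ℂ) := by push_cast; rfl
      rw [h2, Complex.im_mul_ofReal] at h
      exact (mul_eq_zero.1 h).resolve_right (by positivity)

lemma ofReal_genCoeff {e : ℕ → ℝ} {D : ℝ} (he : ∀ k, |e (k + 1)| ≤ D) (n : ℕ) :
    (genCoeff e n : ℂ) = iteratedDeriv n (genFun e) 0 / (n.factorial : ℂ) := by
  apply Complex.ext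
  · simp [genCoeff]
  · rw [im_iteratedDeriv_genFun he]; simp

lemma genCoeff_zero (e : ℕ → ℝ) : genCoeff e 0 = 1 := by
  simp [genCoeff, genFun_zero_right]

lemma genCoeff_succ {e : ℕ → ℝ} {D : ℝ} (he : ∀ k, |e (k + 1)| ≤ D) (n : ℕ) :
    ((n : ℝ) + 1) * genCoeff e (n + 1) =
      ∑ k ∈ range (n + 1), e (k + 1) * genCoeff e (n - k) := by
  have h := iteratedDeriv_genFun_succ he n
  simp only [← ofReal_genCoeff he] at h
  rw [mul_comm]
  exact_mod_cast h

lemma hasSum_genCoeff {e : ℕ → ℝ} {D : ℝ} (he : ∀ k, |e (k + 1)| ≤ D) {z : ℂ} (hz : ‖z‖ < 1) :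
    HasSum (fun j : ℕ => (genCoeff e j : ℂ) * z ^ j) (genFun e z) := by
  have h := Complex.hasSum_taylorSeries_on_ball (differentiableOn_genFun he)
    (z := z) (by simpa using hz)
  have hfun : (fun j : ℕ => (genCoeff e j : ℂ) * z ^ j) =
      fun n : ℕ => (n.factorial : ℂ)⁻¹ • (z - 0) ^ n • iteratedDeriv n (genFun e) 0 := by
    funext j
    rw [ofReal_genCoeff he]
    simp only [smul_eq_mul, sub_zero]
    ring
  rw [hfun]
  exact h

/-! ### Real values, products, dilations and growth. -/

/-- The real values of `genFun` on the real axis. -/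
noncomputable def genReal (e : ℕ → ℝ) (x : ℝ) : ℝ :=
  Real.exp (∑' k : ℕ, e (k + 1) / ((k : ℝ) + 1) * x ^ (k + 1))

lemma genFun_ofReal (e : ℕ → ℝ) (x : ℝ) : genFun e (x : ℂ) = (genReal e x : ℂ) := by
  simp [genFun, genReal, Complex.ofReal_tsum]

lemma genReal_pos (e : ℕ → ℝ) (x : ℝ) : 0 < genReal e x := Real.exp_pos _

lemma hasSum_genReal {e : ℕ → ℝ} {D : ℝ} (he : ∀ k, |e (k + 1)| ≤ D) {x : ℝ} (hx0 : 0 ≤ x)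
    (hx : x < 1) : HasSum (fun j : ℕ => genCoeff e j * x ^ j) (genReal e x) := by
  have h := hasSum_genCoeff he (z := (x : ℂ)) (by simpa [abs_of_nonneg hx0] using hx)
  rw [genFun_ofReal] at h
  rw [← Complex.hasSum_ofReal]
  simpa using h

lemma abs_le_of_nonneg_of_le {e : ℕ → ℝ} {D : ℝ} (h0 : ∀ k, 0 ≤ e (k + 1))
    (hD : ∀ k, e (k + 1) ≤ D) (k : ℕ) : |e (k + 1)| ≤ D := by
  rw [abs_of_nonneg (h0 k)]; exact hD k

lemma summable_exponent {e : ℕ → ℝ} {D : ℝ} (he : ∀ k, |e (k + 1)| ≤ D) {x : ℝ} (hx0 : 0 ≤ x)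
    (hx : x < 1) : Summable fun k : ℕ => e (k + 1) / ((k : ℝ) + 1) * x ^ (k + 1) := by
  refine Summable.of_norm_bounded ((summable_geometric_of_lt_one hx0 hx).mul_left D) fun k => ?_
  have hD : 0 ≤ D := (abs_nonneg _).trans (he 0)
  rw [norm_mul, norm_pow, norm_div, Real.norm_eq_abs, Real.norm_of_nonneg hx0,
    Real.norm_of_nonneg (by positivity)]
  refine mul_le_mul ?_ (pow_le_pow_of_le_one hx0 hx.le (Nat.le_succ k)) (by positivity) hD
  exact (div_le_self (abs_nonneg _) (by linarith [Nat.cast_nonneg (α := ℝ) k])).trans (he k)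

lemma summable_exponent_complex {e : ℕ → ℝ} {D : ℝ} (he : ∀ k, |e (k + 1)| ≤ D) {z : ℂ}
    (hz : ‖z‖ < 1) :
    Summable fun k : ℕ => ((e (k + 1) : ℂ) / ((k : ℂ) + 1)) * z ^ (k + 1) := by
  have h := summable_exponent (e := fun k => |e k|) (D := D) (fun k => by simpa using he k)
    (norm_nonneg z) hz
  refine Summable.of_norm_bounded h fun k => ?_
  rw [norm_mul, norm_pow, norm_div]
  have : ‖(k : ℂ) + 1‖ = (k : ℝ) + 1 := by
    rw [← Nat.cast_succ, Complex.norm_natCast, Nat.cast_succ]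
  rw [this]
  simp

lemma genFun_add {e f : ℕ → ℝ} {D E : ℝ} (he : ∀ k, |e (k + 1)| ≤ D) (hf : ∀ k, |f (k + 1)| ≤ E)
    {z : ℂ} (hz : ‖z‖ < 1) : genFun (fun k => e k + f k) z = genFun e z * genFun f z := by
  unfold genFun
  rw [← Complex.exp_add,
    ← (summable_exponent_complex he hz).tsum_add (summable_exponent_complex hf hz)]
  congr 1
  refine tsum_congr fun k => ?_
  push_cast
  ring

lemma genReal_add {e f : ℕ → ℝ} {D E : ℝ} (he : ∀ k, |e (k + 1)| ≤ D)
    (hf : ∀ k, |f (k + 1)| ≤ E) {x : ℝ} (hx0 : 0 ≤ x) (hx : x < 1) :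
    genReal (fun k => e k + f k) x = genReal e x * genReal f x := by
  have h := genFun_add he hf (z := (x : ℂ)) (by simpa [abs_of_nonneg hx0] using hx)
  rw [genFun_ofReal, genFun_ofReal, genFun_ofReal] at h
  exact_mod_cast h

lemma genCoeff_add {e f : ℕ → ℝ} {D E : ℝ} (he : ∀ k, |e (k + 1)| ≤ D)
    (hf : ∀ k, |f (k + 1)| ≤ E) (n : ℕ) :
    genCoeff (fun k => e k + f k) n = ∑ i ∈ range (n + 1), genCoeff e i * genCoeff f (n - i) := by
  have hef : ∀ k, |e (k + 1) + f (k + 1)| ≤ D + E := fun k =>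
    (abs_add_le _ _).trans (add_le_add (he k) (hf k))
  have hev : genFun (fun k => e k + f k) =ᶠ[𝓝 0] (genFun e * genFun f) := by
    filter_upwards [Metric.ball_mem_nhds (0 : ℂ) one_pos] with z hz
    exact genFun_add he hf (by simpa using hz)
  have hA : AnalyticAt ℂ (genFun e) 0 :=
    (differentiableOn_genFun he).analyticAt (Metric.ball_mem_nhds _ one_pos)
  have hB : AnalyticAt ℂ (genFun f) 0 :=
    (differentiableOn_genFun hf).analyticAt (Metric.ball_mem_nhds _ one_pos)
  rw [← Complex.ofReal_inj, ofReal_genCoeff (e := fun k => e k + f k) hef, hev.iteratedDeriv_eq n,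
    iteratedDeriv_mul hA.contDiffAt hB.contDiffAt, Finset.sum_div]
  push_cast
  refine Finset.sum_congr rfl fun k hk => ?_
  have hkn : k ≤ n := by simpa [Nat.lt_succ_iff] using hk
  rw [ofReal_genCoeff he, ofReal_genCoeff hf, Nat.choose_eq_factorial_div_factorial hkn,
    Nat.cast_div (Nat.factorial_mul_factorial_dvd_factorial hkn) (by
      exact_mod_cast mul_ne_zero (Nat.factorial_ne_zero k) (Nat.factorial_ne_zero (n - k)))]
  have := Nat.factorial_ne_zero n
  have := Nat.factorial_ne_zero k
  have := Nat.factorial_ne_zero (n - k)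
  push_cast
  field_simp

lemma abs_mul_pow_le {e : ℕ → ℝ} {D : ℝ} (he : ∀ k, |e (k + 1)| ≤ D) {x : ℝ} (hx0 : 0 ≤ x)
    (hx : x ≤ 1) (k : ℕ) : |e (k + 1) * x ^ (k + 1)| ≤ D := by
  rw [abs_mul, abs_of_nonneg (pow_nonneg hx0 _)]
  exact (mul_le_of_le_one_right (abs_nonneg _) (pow_le_one₀ hx0 hx)).trans (he k)

/-- Shows that `p(xz)` belongs to the same family, with exponents `e_k x^k`. Products and quotients
of such functions then become sums and differences of exponent sequences. -/
lemma genCoeff_scale {e : ℕ → ℝ} {D : ℝ} (he : ∀ k, |e (k + 1)| ≤ D) {x : ℝ} (hx0 : 0 ≤ x)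
    (hx : x ≤ 1) (n : ℕ) : genCoeff (fun k => e k * x ^ k) n = x ^ n * genCoeff e n := by
  induction n using Nat.strong_induction_on with
  | _ n ih =>
    rcases n with _ | n
    · simp [genCoeff_zero]
    · have hpos : (n : ℝ) + 1 ≠ 0 := by positivity
      refine mul_left_cancel₀ hpos ?_
      rw [genCoeff_succ (e := fun k => e k * x ^ k) (abs_mul_pow_le he hx0 hx), mul_left_comm,
        genCoeff_succ he, Finset.mul_sum]
      refine Finset.sum_congr rfl fun k hk => ?_
      have hkn : k ≤ n := by simpa [Nat.lt_succ_iff] using hk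
      rw [ih (n - k) (by omega)]
      have : x ^ (n + 1) = x ^ (k + 1) * x ^ (n - k) := by rw [← pow_add]; congr 1; omega
      rw [this]; ring

lemma genReal_scale (e : ℕ → ℝ) (x y : ℝ) :
    genReal (fun k => e k * x ^ k) y = genReal e (x * y) := by
  unfold genReal
  congr 1
  refine tsum_congr fun k => ?_
  rw [mul_pow]; ring

lemma genCoeff_nonneg {e : ℕ → ℝ} {D : ℝ} (h0 : ∀ k, 0 ≤ e (k + 1)) (hD : ∀ k, e (k + 1) ≤ D)
    (n : ℕ) : 0 ≤ genCoeff e n := by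
  induction n using Nat.strong_induction_on with
  | _ n ih =>
    rcases n with _ | n
    · simp [genCoeff_zero]
    · have hpos : (0 : ℝ) < (n : ℝ) + 1 := by positivity
      refine nonneg_of_mul_nonneg_right ?_ hpos
      rw [genCoeff_succ (abs_le_of_nonneg_of_le h0 hD)]
      exact Finset.sum_nonneg fun k _ => mul_nonneg (h0 k) (ih _ (by omega))

lemma genCoeff_pos {e : ℕ → ℝ} {D : ℝ} (h0 : ∀ k, 0 < e (k + 1)) (hD : ∀ k, e (k + 1) ≤ D)
    (n : ℕ) : 0 < genCoeff e n := by
  induction n using Nat.strong_induction_on with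
  | _ n ih =>
    rcases n with _ | n
    · simp [genCoeff_zero]
    · have hpos : (0 : ℝ) < (n : ℝ) + 1 := by positivity
      refine pos_of_mul_pos_right ?_ hpos.le
      rw [genCoeff_succ (abs_le_of_nonneg_of_le (fun k => (h0 k).le) hD)]
      exact Finset.sum_pos (fun k _ => mul_pos (h0 k) (ih _ (by omega))) (by simp)

lemma genReal_mono {e : ℕ → ℝ} {D : ℝ} (h0 : ∀ k, 0 ≤ e (k + 1)) (hD : ∀ k, e (k + 1) ≤ D)
    {x y : ℝ} (hx0 : 0 ≤ x) (hxy : x ≤ y) (hy : y < 1) : genReal e x ≤ genReal e y := by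
  have he := abs_le_of_nonneg_of_le h0 hD
  refine Real.exp_le_exp.2 (Summable.tsum_le_tsum (fun k => ?_)
    (summable_exponent he hx0 (hxy.trans_lt hy)) (summable_exponent he (hx0.trans hxy) hy))
  have := h0 k
  gcongr

lemma genReal_const (s : ℝ) {x : ℝ} (hx0 : 0 ≤ x) (hx : x < 1) :
    genReal (fun _ => s) x = (1 - x) ^ (-s) := by
  have h := Real.hasSum_pow_div_log_of_abs_lt_one (x := x) (by rwa [abs_of_nonneg hx0])
  rw [Real.rpow_def_of_pos (by linarith), genReal]
  congr 1
  rw [mul_neg, ← neg_mul, mul_comm]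
  rw [show s * -Real.log (1 - x) = ∑' n : ℕ, s * (x ^ (n + 1) / ((n : ℝ) + 1)) by
    rw [tsum_mul_left, h.tsum_eq]]
  exact tsum_congr fun k => by ring

/-- Growth of `genReal e` is at most that of `(1 - x) ^ (-s)` when `e ≤ s`. -/
lemma genReal_le_mul_rpow {e : ℕ → ℝ} {D s : ℝ} (he : ∀ k, |e (k + 1)| ≤ D)
    (hs : ∀ k, e (k + 1) ≤ s) {x y : ℝ} (hx0 : 0 ≤ x) (hxy : x ≤ y) (hy : y < 1) :
    genReal e y ≤ genReal e x * ((1 - x) / (1 - y)) ^ s := by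
  have hf : ∀ k, s - e (k + 1) ≤ s + D := fun k => by linarith [neg_abs_le (e (k + 1)), he k]
  have hf0 : ∀ k, 0 ≤ s - e (k + 1) := fun k => by linarith [hs k]
  have hfa := abs_le_of_nonneg_of_le (e := fun k => s - e k) hf0 hf
  have hx : x < 1 := hxy.trans_lt hy
  -- The complementary exponents `s - e_k` are nonnegative, so `(1 - t)^(-s)` is `p(t)` times a
  -- nondecreasing function.
  have h : ∀ t, 0 ≤ t → t < 1 → genReal e t * genReal (fun k => s - e k) t = (1 - t) ^ (-s) := by
    intro t ht0 ht
    rw [← genReal_add he hfa ht0 ht, ← genReal_const s ht0 ht]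
    congr 1
    funext k
    ring
  have hm := genReal_mono (e := fun k => s - e k) hf0 hf hx0 hxy hy
  have hpx := genReal_pos (fun k => s - e k) x
  have hpy := genReal_pos (fun k => s - e k) y
  have h1 := h x hx0 hx
  have h2 := h y (hx0.trans hxy) hy
  have hx1 : 0 < 1 - x := by linarith
  have hy1 : 0 < 1 - y := by linarith
  have e1 : genReal e y ≤ (1 - y) ^ (-s) / genReal (fun k => s - e k) x := by
    rw [← h2, le_div_iff₀ hpx]
    exact mul_le_mul_of_nonneg_left hm (genReal_pos e y).le
  refine e1.trans (le_of_eq ?_)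
  rw [eq_div_of_mul_eq hpx.ne' h1, Real.div_rpow hx1.le hy1.le, Real.rpow_neg hx1.le,
    Real.rpow_neg hy1.le]
  have p1 := Real.rpow_pos_of_pos hx1 s
  have p2 := Real.rpow_pos_of_pos hy1 s
  field_simp

/-- Growth of `genReal e` is at least that of `(1 - x) ^ (-s)` when `s ≤ e`. -/
lemma mul_rpow_le_genReal {e : ℕ → ℝ} {D s : ℝ} (he : ∀ k, |e (k + 1)| ≤ D)
    (hs : ∀ k, s ≤ e (k + 1)) {x y : ℝ} (hx0 : 0 ≤ x) (hxy : x ≤ y) (hy : y < 1) :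
    genReal e x * ((1 - x) / (1 - y)) ^ s ≤ genReal e y := by
  have hf : ∀ k, e (k + 1) - s ≤ D - s := fun k => by linarith [le_abs_self (e (k + 1)), he k]
  have hf0 : ∀ k, 0 ≤ e (k + 1) - s := fun k => by linarith [hs k]
  have hfa := abs_le_of_nonneg_of_le (e := fun k => e k - s) hf0 hf
  have hx : x < 1 := hxy.trans_lt hy
  have h : ∀ t, 0 ≤ t → t < 1 → genReal e t = genReal (fun k => e k - s) t * (1 - t) ^ (-s) := by
    intro t ht0 ht
    rw [← genReal_const s ht0 ht, ← genReal_add (f := fun _ => s) hfa (fun _ => le_refl |s|) ht0 ht]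
    congr 1
    funext k
    ring
  have hm := genReal_mono (e := fun k => e k - s) hf0 hf hx0 hxy hy
  have hx1 : 0 < 1 - x := by linarith
  have hy1 : 0 < 1 - y := by linarith
  rw [h x hx0 hx, h y (hx0.trans hxy) hy, Real.div_rpow hx1.le hy1.le, Real.rpow_neg hx1.le,
    Real.rpow_neg hy1.le]
  have p1 := Real.rpow_pos_of_pos hx1 s
  have p2 := Real.rpow_pos_of_pos hy1 s
  rw [show ∀ a : ℝ, a * ((1 - x) ^ s)⁻¹ * ((1 - x) ^ s / (1 - y) ^ s) = a * ((1 - y) ^ s)⁻¹ by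
    intro a; field_simp]
  gcongr

/-! ### The radius `e^{-1/n}`. -/

/-- The radius `e ^ (-1 / n)`. -/
noncomputable def rad (n : ℕ) : ℝ := Real.exp (-1 / (n : ℝ))

lemma rad_pos (n : ℕ) : 0 < rad n := Real.exp_pos _

lemma rad_lt_one {n : ℕ} (hn : 1 ≤ n) : rad n < 1 := by
  have : (0 : ℝ) < n := by exact_mod_cast hn
  rw [rad, Real.exp_lt_one_iff]
  exact div_neg_of_neg_of_pos (by norm_num) this

lemma one_sub_rad_le (n : ℕ) : 1 - rad n ≤ 1 / n := by
  have := Real.add_one_le_exp (-1 / (n : ℝ))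
  rw [rad]
  have h : (-1 : ℝ) / n = -(1 / n) := by ring
  rw [h] at this ⊢
  linarith

lemma one_div_le_one_sub_rad {n : ℕ} (hn : 1 ≤ n) : 1 / (2 * n : ℝ) ≤ 1 - rad n := by
  have h1 : (1 : ℝ) ≤ n := by exact_mod_cast hn
  have h := Real.add_one_le_exp (1 / (n : ℝ))
  have hr : rad n = (Real.exp (1 / (n : ℝ)))⁻¹ := by
    rw [rad, ← Real.exp_neg]; congr 1; ring
  have h2 : rad n ≤ (1 / (n : ℝ) + 1)⁻¹ := by
    rw [hr]; exact inv_anti₀ (by positivity) h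
  have h3 : (1 / (n : ℝ) + 1)⁻¹ ≤ 1 - 1 / (2 * n : ℝ) := by
    have : 1 - 1 / (2 * n : ℝ) - (1 / (n : ℝ) + 1)⁻¹ = (n - 1) / (2 * n * (n + 1)) := by
      field_simp
      ring
    have h4 : 0 ≤ ((n : ℝ) - 1) / (2 * n * (n + 1)) := div_nonneg (by linarith) (by positivity)
    linarith
  linarith

lemma rad_mono {m n : ℕ} (hm : 1 ≤ m) (hmn : m ≤ n) : rad m ≤ rad n := by
  have h1 : (0 : ℝ) < m := by exact_mod_cast hm
  have h2 : (m : ℝ) ≤ n := by exact_mod_cast hmn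
  rw [rad, rad, Real.exp_le_exp, neg_div, neg_div]
  exact neg_le_neg (one_div_le_one_div_of_le h1 h2)

lemma rad_pow (n m : ℕ) : rad n ^ m = Real.exp (-(m : ℝ) / n) := by
  rw [rad, ← Real.exp_nat_mul]; congr 1; ring

lemma one_le_three_mul_rad_pow {n m : ℕ} (hmn : m ≤ n) : 1 ≤ 3 * rad n ^ m := by
  have h : Real.exp (-1) ≤ rad n ^ m := by
    rw [rad_pow, Real.exp_le_exp, neg_div, neg_le_neg_iff]
    exact div_le_one_of_le₀ (by exact_mod_cast hmn) (by positivity)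
  have h2 : 1 ≤ 3 * Real.exp (-1) := by
    rw [Real.exp_neg, ← div_eq_mul_inv, one_le_div (Real.exp_pos 1)]
    linarith [Real.exp_one_lt_d9]
  linarith

/-! ### Coefficients and their partial sums against `p(e^{-1/n})`. -/

lemma sum_genCoeff_mul_pow_le {e : ℕ → ℝ} {D : ℝ} (h0 : ∀ k, 0 ≤ e (k + 1))
    (hD : ∀ k, e (k + 1) ≤ D) {x : ℝ} (hx0 : 0 ≤ x) (hx : x < 1) (s : Finset ℕ) :
    ∑ m ∈ s, genCoeff e m * x ^ m ≤ genReal e x :=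
  sum_le_hasSum s (fun m _ => mul_nonneg (genCoeff_nonneg h0 hD m) (pow_nonneg hx0 m))
    (hasSum_genReal (abs_le_of_nonneg_of_le h0 hD) hx0 hx)

lemma sum_genCoeff_le {e : ℕ → ℝ} {D : ℝ} (h0 : ∀ k, 0 ≤ e (k + 1)) (hD : ∀ k, e (k + 1) ≤ D)
    {n : ℕ} (hn : 1 ≤ n) : ∑ m ∈ range (n + 1), genCoeff e m ≤ 3 * genReal e (rad n) := by
  have h := sum_genCoeff_mul_pow_le h0 hD (rad_pos n).le (rad_lt_one hn) (range (n + 1))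
  calc ∑ m ∈ range (n + 1), genCoeff e m
      ≤ ∑ m ∈ range (n + 1), 3 * (genCoeff e m * rad n ^ m) := by
        refine sum_le_sum fun m hm => ?_
        have h1 := one_le_three_mul_rad_pow (n := n) (m := m) (by simpa [Nat.lt_succ_iff] using hm)
        nlinarith [genCoeff_nonneg h0 hD m]
    _ ≤ _ := by rw [← mul_sum]; linarith

/-- Only the first `n` exponents enter the recurrence, so `B` may depend on `n`; `genCoeff_defl_le`
uses this freedom. -/
lemma mul_genCoeff_le_sum {e : ℕ → ℝ} {D B : ℝ} (h0 : ∀ k, 0 ≤ e (k + 1))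
    (hD : ∀ k, e (k + 1) ≤ D) {n : ℕ} (hB : ∀ k, k < n → e (k + 1) ≤ B) :
    (n : ℝ) * genCoeff e n ≤ B * ∑ m ∈ range n, genCoeff e m := by
  rcases n with _ | n
  · simp
  · push_cast
    rw [genCoeff_succ (abs_le_of_nonneg_of_le h0 hD), ← sum_range_reflect (genCoeff e), mul_sum]
    refine sum_le_sum fun k hk => ?_
    rw [show n + 1 - 1 - k = n - k by omega]
    exact mul_le_mul_of_nonneg_right (hB k (by simpa using hk)) (genCoeff_nonneg h0 hD _)

lemma sum_le_mul_genCoeff {e : ℕ → ℝ} {D b : ℝ} (h0 : ∀ k, 0 ≤ e (k + 1))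
    (hD : ∀ k, e (k + 1) ≤ D) (hb : ∀ k, b ≤ e (k + 1)) (n : ℕ) :
    b * ∑ m ∈ range n, genCoeff e m ≤ (n : ℝ) * genCoeff e n := by
  rcases n with _ | n
  · simp
  · push_cast
    rw [genCoeff_succ (abs_le_of_nonneg_of_le h0 hD), ← sum_range_reflect (genCoeff e), mul_sum]
    refine sum_le_sum fun k hk => ?_
    rw [show n + 1 - 1 - k = n - k by omega]
    exact mul_le_mul_of_nonneg_right (hb k) (genCoeff_nonneg h0 hD _)

lemma mul_genCoeff_le {e : ℕ → ℝ} {D : ℝ} (h0 : ∀ k, 0 ≤ e (k + 1)) (hD : ∀ k, e (k + 1) ≤ D)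
    {i n : ℕ} (hn : 1 ≤ n) (hin : i ≤ n) :
    (i : ℝ) * genCoeff e i ≤ 3 * D * genReal e (rad n) := by
  have hD0 : 0 ≤ D := (h0 0).trans (hD 0)
  calc (i : ℝ) * genCoeff e i ≤ D * ∑ m ∈ range i, genCoeff e m :=
        mul_genCoeff_le_sum h0 hD fun k _ => hD k
    _ ≤ D * ∑ m ∈ range (n + 1), genCoeff e m := by
        refine mul_le_mul_of_nonneg_left (sum_le_sum_of_subset_of_nonneg ?_ ?_) hD0
        · exact range_subset_range.2 (by omega)
        · exact fun m _ _ => genCoeff_nonneg h0 hD m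
    _ ≤ D * (3 * genReal e (rad n)) := mul_le_mul_of_nonneg_left (sum_genCoeff_le h0 hD hn) hD0
    _ = _ := by ring

lemma genReal_le_two_pow_mul {e : ℕ → ℝ} {D : ℕ} (h0 : ∀ k, 0 ≤ e (k + 1))
    (hD : ∀ k, e (k + 1) ≤ D) {s : ℝ} (hs0 : 0 ≤ s) (hs : s < 1) :
    genReal e s ≤ 2 ^ D * genReal e (s ^ 2) := by
  have h := genReal_le_mul_rpow (abs_le_of_nonneg_of_le h0 hD) hD (sq_nonneg s)
    (by nlinarith : s ^ 2 ≤ s) hs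
  rw [Real.rpow_natCast] at h
  have h1 : (1 - s ^ 2) / (1 - s) = 1 + s := by
    rw [div_eq_iff (by linarith)]; ring
  rw [h1, mul_comm] at h
  refine h.trans (mul_le_mul_of_nonneg_right ?_ (genReal_pos _ _).le)
  exact pow_le_pow_left₀ (by linarith) (by linarith) D

/-- The tail of the series for `genReal e (s ^ 2)`. -/
lemma genReal_sub_sum_le {e : ℕ → ℝ} {D : ℕ} (h0 : ∀ k, 0 ≤ e (k + 1))
    (hD : ∀ k, e (k + 1) ≤ D) {s : ℝ} (hs0 : 0 ≤ s) (hs : s < 1) (M : ℕ) :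
    genReal e (s ^ 2) - ∑ m ∈ range M, genCoeff e m * (s ^ 2) ^ m ≤
      2 ^ D * s ^ M * genReal e (s ^ 2) := by
  have he := abs_le_of_nonneg_of_le h0 hD
  have h1 := hasSum_genReal he (sq_nonneg s) (by nlinarith : s ^ 2 < 1)
  have h2 := hasSum_genReal he hs0 hs
  have t1 := (hasSum_nat_add_iff' M).2 h1
  have t2 := ((hasSum_nat_add_iff' M).2 h2).mul_left (s ^ M)
  have h3 := hasSum_le (fun m => ?_) t1 t2
  · have h4 : 0 ≤ ∑ m ∈ range M, genCoeff e m * s ^ m :=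
      sum_nonneg fun m _ => mul_nonneg (genCoeff_nonneg h0 hD m) (pow_nonneg hs0 m)
    have h5 : 0 ≤ s ^ M := pow_nonneg hs0 M
    calc _ ≤ s ^ M * (genReal e s - ∑ m ∈ range M, genCoeff e m * s ^ m) := h3
      _ ≤ s ^ M * (2 ^ D * genReal e (s ^ 2)) := by
        refine mul_le_mul_of_nonneg_left ?_ h5
        linarith [genReal_le_two_pow_mul h0 hD hs0 hs]
      _ = _ := by ring
  -- Of the two factors `s^(m+M)` in `(s^2)^(m+M)`, one is at most `s^M`; the other leaves a tail of
  -- the series at `s`, and `p(s) ≤ 2^D p(s^2)`.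
  · rw [← pow_mul, two_mul, pow_add, mul_left_comm]
    refine mul_le_mul_of_nonneg_right ?_
      (mul_nonneg (genCoeff_nonneg h0 hD _) (pow_nonneg hs0 _))
    exact pow_le_pow_of_le_one hs0 hs.le (by omega)

/-- At a slightly smaller radius `s^2`, at least half of `p(s^2)` comes from the first `n` terms,
and the lower bound `b` in the recurrence bounds their sum by `n p_n / b`. Passing from `s^2` back
to `e^{-1/n}` costs a constant, both being within `O(1/n)` of `1`. -/
lemma genReal_rad_le {e : ℕ → ℝ} {D : ℕ} {b : ℝ} (hb0 : 0 < b) (hb : ∀ k, b ≤ e (k + 1))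
    (hD : ∀ k, e (k + 1) ≤ D) {n : ℕ} (hn : 1 ≤ n) :
    genReal e (rad n) ≤ 2 * (4 * (D + 1)) ^ D / b * (n * genCoeff e n) := by
  have h0 : ∀ k, 0 ≤ e (k + 1) := fun k => hb0.le.trans (hb k)
  have hn0 : (0 : ℝ) < n := by exact_mod_cast hn
  -- The exponent makes `s^n = e^{-(D+1)} ≤ 2^{-(D+1)}`, which beats the factor `2^D` in the tail
  -- estimate.
  set s : ℝ := rad n ^ (D + 1) with hs_def
  have hs0 : 0 ≤ s := pow_nonneg (rad_pos n).le _
  have hs1 : s < 1 := pow_lt_one₀ (rad_pos n).le (rad_lt_one hn) (by omega)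
  have htail := genReal_sub_sum_le h0 hD hs0 hs1 n
  have hsn : 2 ^ D * s ^ n ≤ 1 / 2 := by
    have h1 : s ^ n = (Real.exp (-1)) ^ (D + 1) := by
      rw [hs_def, ← pow_mul, mul_comm, pow_mul, rad_pow]
      congr 2
      field_simp
    have h2 : Real.exp (-1) ≤ 1 / 2 := by
      rw [Real.exp_neg, ← one_div]
      exact one_div_le_one_div_of_le (by norm_num) (by linarith [Real.exp_one_gt_d9])
    rw [h1]
    calc (2 : ℝ) ^ D * Real.exp (-1) ^ (D + 1) ≤ 2 ^ D * (1 / 2) ^ (D + 1) := by gcongr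
      _ = 1 / 2 := by rw [pow_succ, ← mul_assoc, ← mul_pow]; norm_num
  have hpos := genReal_pos e (s ^ 2)
  have hsum : ∑ m ∈ range n, genCoeff e m * (s ^ 2) ^ m ≤ ∑ m ∈ range n, genCoeff e m := by
    refine sum_le_sum fun m _ => mul_le_of_le_one_right (genCoeff_nonneg h0 hD m) ?_
    exact pow_le_one₀ (sq_nonneg s) (by nlinarith)
  have hhalf : genReal e (s ^ 2) ≤ 2 * ∑ m ∈ range n, genCoeff e m := by
    have := mul_le_mul_of_nonneg_right hsn hpos.le
    linarith
  have hs2 : s ^ 2 ≤ rad n := by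
    rw [hs_def, ← pow_mul]
    exact pow_le_of_le_one (rad_pos n).le (rad_lt_one hn).le (by omega)
  have hgrow := genReal_le_mul_rpow (abs_le_of_nonneg_of_le h0 hD) hD (sq_nonneg s) hs2
    (rad_lt_one hn)
  rw [Real.rpow_natCast] at hgrow
  have hratio : (1 - s ^ 2) / (1 - rad n) ≤ 4 * (D + 1) := by
    have hlow := one_div_le_one_sub_rad hn
    have hr1 : 0 < 1 - rad n := by linarith [rad_lt_one hn]
    rw [div_le_iff₀ hr1]
    have h1 : 1 - s ^ 2 ≤ 2 * (D + 1) * (1 - rad n) := by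
      have := one_add_mul_le_pow (a := rad n - 1) (by linarith [rad_pos n]) (2 * (D + 1))
      have hp : s ^ 2 = (1 + (rad n - 1)) ^ (2 * (D + 1)) := by
        rw [hs_def, ← pow_mul]; congr 1 <;> ring
      rw [hp]
      push_cast at this
      linarith
    nlinarith [Nat.cast_nonneg (α := ℝ) D]
  have hr0 : 0 ≤ (1 - s ^ 2) / (1 - rad n) :=
    div_nonneg (by nlinarith) (by linarith [rad_lt_one hn])
  have hlow := sum_le_mul_genCoeff h0 hD hb n
  have hsumle : ∑ m ∈ range n, genCoeff e m ≤ n * genCoeff e n / b := by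
    rw [le_div_iff₀ hb0]; linarith
  calc genReal e (rad n) ≤ genReal e (s ^ 2) * ((1 - s ^ 2) / (1 - rad n)) ^ D := hgrow
    _ ≤ (2 * (n * genCoeff e n / b)) * (4 * (D + 1)) ^ D := by
        have hle : genReal e (s ^ 2) ≤ 2 * (n * genCoeff e n / b) := by linarith
        exact mul_le_mul hle (pow_le_pow_left₀ hr0 hratio D) (pow_nonneg hr0 D) (hpos.le.trans hle)
    _ = _ := by ring

lemma rad_le_mul_one_sub_rad {n : ℕ} (hn : 1 ≤ n) : rad n ≤ n * (1 - rad n) := by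
  have h1 : (0 : ℝ) < n := by exact_mod_cast hn
  have h := Real.add_one_le_exp (1 / (n : ℝ))
  have hr : rad n * Real.exp (1 / (n : ℝ)) = 1 := by
    rw [rad, ← Real.exp_add, ← Real.exp_zero]; congr 1; ring
  have h2 : rad n * (1 / (n : ℝ) + 1) ≤ 1 := by
    exact (mul_le_mul_of_nonneg_left h (rad_pos n).le).trans hr.le
  have h3 : rad n * (1 / (n : ℝ) + 1) * n = rad n * (1 + n) := by field_simp
  nlinarith

/-! ### The quotient `p(z) / p(xz)`. -/

/-- The exponent sequence of `p(z) / p(x z)` when `e` is that of `p`. -/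
def defl (x : ℝ) (e : ℕ → ℝ) (k : ℕ) : ℝ := e k * (1 - x ^ k)

lemma defl_nonneg {e : ℕ → ℝ} (h0 : ∀ k, 0 ≤ e (k + 1)) {x : ℝ} (hx0 : 0 ≤ x) (hx : x ≤ 1)
    (k : ℕ) : 0 ≤ defl x e (k + 1) :=
  mul_nonneg (h0 k) (by linarith [pow_le_one₀ (n := k + 1) hx0 hx])

lemma defl_le {e : ℕ → ℝ} {D : ℝ} (h0 : ∀ k, 0 ≤ e (k + 1)) (hD : ∀ k, e (k + 1) ≤ D) {x : ℝ}
    (hx0 : 0 ≤ x) (k : ℕ) : defl x e (k + 1) ≤ D :=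
  (mul_le_of_le_one_right (h0 k) (by linarith [pow_nonneg hx0 (k + 1)])).trans (hD k)

lemma genReal_defl_mul {e : ℕ → ℝ} {D : ℝ} (h0 : ∀ k, 0 ≤ e (k + 1)) (hD : ∀ k, e (k + 1) ≤ D)
    {x y : ℝ} (hx0 : 0 ≤ x) (hx : x ≤ 1) (hy0 : 0 ≤ y) (hy : y < 1) :
    genReal (defl x e) y * genReal e (x * y) = genReal e y := by
  have he := abs_le_of_nonneg_of_le h0 hD
  have hd := abs_le_of_nonneg_of_le (defl_nonneg h0 hx0 hx) (defl_le h0 hD hx0)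
  rw [← genReal_scale, ← genReal_add (f := fun k => e k * x ^ k) hd (abs_mul_pow_le he hx0 hx) hy0 hy]
  congr 1
  funext k
  simp only [defl]; ring

lemma genCoeff_eq_sum_defl {e : ℕ → ℝ} {D : ℝ} (h0 : ∀ k, 0 ≤ e (k + 1))
    (hD : ∀ k, e (k + 1) ≤ D) {x : ℝ} (hx0 : 0 ≤ x) (hx : x ≤ 1) (n : ℕ) :
    genCoeff e n = ∑ m ∈ range (n + 1), genCoeff e m * x ^ m * genCoeff (defl x e) (n - m) := by
  have he := abs_le_of_nonneg_of_le h0 hD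
  have hd := abs_le_of_nonneg_of_le (defl_nonneg h0 hx0 hx) (defl_le h0 hD hx0)
  have h := genCoeff_add (e := fun k => e k * x ^ k) (abs_mul_pow_le he hx0 hx) hd n
  simp only [genCoeff_scale he hx0 hx] at h
  rw [show (fun k => e k * x ^ k + defl x e k) = e by funext k; simp only [defl]; ring] at h
  rw [h]
  exact sum_congr rfl fun m _ => by ring

/-- Exhibits the coefficient as a polynomial in `x` on `[0, 1]`, which gives continuity and allows
exact integration. -/
lemma genCoeff_defl_eq_sum {e : ℕ → ℝ} {D : ℝ} (h0 : ∀ k, 0 ≤ e (k + 1))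
    (hD : ∀ k, e (k + 1) ≤ D) {x : ℝ} (hx0 : 0 ≤ x) (hx : x ≤ 1) (n : ℕ) :
    genCoeff (defl x e) n =
      ∑ m ∈ range (n + 1), genCoeff (fun k => -e k) m * x ^ m * genCoeff e (n - m) := by
  have he := abs_le_of_nonneg_of_le h0 hD
  have hneg : ∀ k, |-e (k + 1)| ≤ D := fun k => by rw [abs_neg]; exact he k
  have h := genCoeff_add (e := fun k => -e k * x ^ k)
    (abs_mul_pow_le (e := fun k => -e k) hneg hx0 hx) he n
  simp only [genCoeff_scale (e := fun k => -e k) hneg hx0 hx] at h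
  rw [show (fun k => -e k * x ^ k + e k) = defl x e by funext k; simp only [defl]; ring] at h
  rw [h]
  exact sum_congr rfl fun m _ => by ring

/-- With `r = e^{-1/n}` the quotient is `1 + (1 - x) r / (1 - r)`, and `r / (1 - r) ≤ n`. -/
lemma one_sub_mul_rad_div_le {n : ℕ} (hn : 1 ≤ n) {x : ℝ} (hx : x ≤ 1) :
    (1 - x * rad n) / (1 - rad n) ≤ 1 + n * (1 - x) := by
  have hr : 0 < 1 - rad n := by linarith [rad_lt_one hn]
  rw [div_le_iff₀ hr]
  have := mul_le_mul_of_nonneg_right (rad_le_mul_one_sub_rad hn) (by linarith : 0 ≤ 1 - x)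
  nlinarith

lemma genReal_defl_rad_le {e : ℕ → ℝ} {D : ℕ} (h0 : ∀ k, 0 ≤ e (k + 1))
    (hD : ∀ k, e (k + 1) ≤ D) {x : ℝ} (hx0 : 0 ≤ x) (hx : x ≤ 1) {n : ℕ} (hn : 1 ≤ n) :
    genReal (defl x e) (rad n) ≤ (1 + n * (1 - x)) ^ D := by
  have hr0 := (rad_pos n).le
  have hr1 := rad_lt_one hn
  have hxr : x * rad n ≤ rad n := mul_le_of_le_one_left hr0 hx
  have h1 := genReal_defl_mul h0 hD hx0 hx hr0 hr1
  have h2 := genReal_le_mul_rpow (abs_le_of_nonneg_of_le h0 hD) hD (mul_nonneg hx0 hr0) hxr hr1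
  rw [Real.rpow_natCast, ← h1, mul_comm] at h2
  refine (le_of_mul_le_mul_left h2 (genReal_pos _ _)).trans ?_
  refine pow_le_pow_left₀ (div_nonneg ?_ ?_) (one_sub_mul_rad_div_le hn hx) D <;> linarith

/-- For `k ≤ n` the exponents satisfy `e_k (1 - x^k) ≤ D n (1 - x)`; the `n` cancels against the one
in the recurrence. The gain is the factor `1 - x`, absent for `n = 0`, where the coefficient is `1`.
-/
lemma genCoeff_defl_le {e : ℕ → ℝ} {D : ℕ} (h0 : ∀ k, 0 ≤ e (k + 1))
    (hD : ∀ k, e (k + 1) ≤ D) {x : ℝ} (hx0 : 0 ≤ x) (hx : x ≤ 1) {n : ℕ} (hn : 1 ≤ n) :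
    genCoeff (defl x e) n ≤ 3 * D * (1 - x) * (1 + n * (1 - x)) ^ D := by
  have hn0 : (0 : ℝ) < n := by exact_mod_cast hn
  have hx1 : 0 ≤ 1 - x := by linarith
  have h1 := mul_genCoeff_le_sum (defl_nonneg h0 hx0 hx) (defl_le h0 hD hx0) (n := n)
    (B := D * (n * (1 - x))) (fun k hk => by
      have hb := one_add_mul_le_pow (a := x - 1) (by linarith) (k + 1)
      have hkn : ((k + 1 : ℕ) : ℝ) ≤ n := by exact_mod_cast hk
      have h3 : 1 - x ^ (k + 1) ≤ n * (1 - x) := by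
        rw [show x ^ (k + 1) = (1 + (x - 1)) ^ (k + 1) by congr 1; ring]
        nlinarith
      exact mul_le_mul (hD k) h3 (by linarith [pow_le_one₀ (n := k + 1) hx0 hx]) (by positivity))
  have h2 : ∑ m ∈ range n, genCoeff (defl x e) m ≤ 3 * (1 + n * (1 - x)) ^ D := by
    calc ∑ m ∈ range n, genCoeff (defl x e) m ≤ ∑ m ∈ range (n + 1), genCoeff (defl x e) m :=
          sum_le_sum_of_subset_of_nonneg (range_subset_range.2 (by omega))
            fun m _ _ => genCoeff_nonneg (defl_nonneg h0 hx0 hx) (defl_le h0 hD hx0) m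
      _ ≤ 3 * genReal (defl x e) (rad n) :=
          sum_genCoeff_le (defl_nonneg h0 hx0 hx) (defl_le h0 hD hx0) hn
      _ ≤ _ := by linarith [genReal_defl_rad_le h0 hD hx0 hx hn]
  have h4 := h1.trans (mul_le_mul_of_nonneg_left h2 (by positivity))
  refine le_of_mul_le_mul_left (h4.trans (le_of_eq ?_)) hn0
  ring

section Binomial

/-! The coefficients of `((1 - x z) / (1 - z)) ^ θ`. -/

variable {x θ : ℝ}

/-- The coefficients of `((1 - x z) / (1 - z)) ^ θ`. -/
noncomputable def ratioCoeff (x θ : ℝ) (m : ℕ) : ℝ := genCoeff (defl x fun _ => θ) m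

lemma ratioCoeff_nonneg (hx0 : 0 ≤ x) (hx : x ≤ 1) (hθ : 0 ≤ θ) (m : ℕ) :
    0 ≤ ratioCoeff x θ m :=
  genCoeff_nonneg (defl_nonneg (fun _ => hθ) hx0 hx) (defl_le (fun _ => hθ) (fun _ => le_rfl) hx0) m

/-- Subtract two consecutive recurrences: the weights `θ (1 - x^(k+1))` and `θ (1 - x^k)` differ by
`θ (1 - x) x^k`. -/
lemma ratioCoeff_diff (hx0 : 0 ≤ x) (hx : x ≤ 1) (hθ : 0 ≤ θ) (m : ℕ) :
    ((m : ℝ) + 1) * ratioCoeff x θ (m + 1) - m * ratioCoeff x θ m =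
      θ * (1 - x) * ∑ k ∈ range (m + 1), x ^ k * ratioCoeff x θ (m - k) := by
  have hb := abs_le_of_nonneg_of_le (defl_nonneg (fun _ => hθ) hx0 hx)
    (defl_le (e := fun _ => θ) (fun _ => hθ) (fun _ => le_rfl) hx0)
  have h1 := genCoeff_succ hb m
  -- The added term `k = 0` vanishes; it aligns the index range with that of `h1`.
  have h2 : (m : ℝ) * ratioCoeff x θ m =
      ∑ k ∈ range (m + 1), θ * (1 - x ^ k) * ratioCoeff x θ (m - k) := by
    rcases m with _ | m
    · simp
    · rw [sum_range_succ']
      have := genCoeff_succ hb m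
      push_cast
      simp only [pow_zero, sub_self, mul_zero, zero_mul, add_zero]
      exact this
  rw [h2]
  unfold ratioCoeff at *
  rw [h1, ← sum_sub_distrib, mul_sum]
  refine sum_congr rfl fun k _ => ?_
  simp only [defl]
  ring

/-- Write `A_m` for the coefficients and `w_m` for the left side. By `ratioCoeff_diff`, `A_{m+1}` is
the average of `A_m` and `w_m` with weights `m/(m+1)` and `1/(m+1)`, so `w_m ≤ A_m` forces `w_m ≤
A_{m+1} ≤ A_m`. Then `w_{m+1} = x w_m + θ (1 - x) A_{m+1} ≤ A_{m+1}`, because `θ ≤ 1`. -/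
lemma ratioCoeff_aux (hx0 : 0 ≤ x) (hx : x ≤ 1) (hθ : 0 ≤ θ) (hθ1 : θ ≤ 1) (m : ℕ) :
    θ * (1 - x) * ∑ k ∈ range (m + 1), x ^ k * ratioCoeff x θ (m - k) ≤ ratioCoeff x θ m := by
  induction m with
  | zero =>
    simp only [ratioCoeff, zero_add, range_one, sum_singleton, Nat.sub_zero, genCoeff_zero, pow_zero]
    nlinarith
  | succ m ih =>
    have hd := ratioCoeff_diff hx0 hx hθ m
    have hA := ratioCoeff_nonneg hx0 hx hθ (m + 1)
    rw [sum_range_succ']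
    simp only [Nat.add_sub_add_right, pow_zero, one_mul, Nat.sub_zero, pow_succ']
    have hW : ∑ k ∈ range (m + 1), x * x ^ k * ratioCoeff x θ (m - k) =
        x * ∑ k ∈ range (m + 1), x ^ k * ratioCoeff x θ (m - k) := by
      rw [mul_sum]; exact sum_congr rfl fun k _ => by ring
    rw [hW]
    set W := ∑ k ∈ range (m + 1), x ^ k * ratioCoeff x θ (m - k)
    set a := ratioCoeff x θ m
    set b := ratioCoeff x θ (m + 1)
    have hm : (0 : ℝ) ≤ m := Nat.cast_nonneg m
    have hba : b ≤ a := by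
      refine le_of_mul_le_mul_left (a := (m : ℝ) + 1) ?_ (by positivity)
      linarith
    have h1 : θ * (1 - x) * W ≤ b := by nlinarith
    calc θ * (1 - x) * (x * W + b) = x * (θ * (1 - x) * W) + θ * ((1 - x) * b) := by ring
      _ ≤ x * b + 1 * ((1 - x) * b) := by
        have : 0 ≤ (1 - x) * b := mul_nonneg (by linarith) hA
        gcongr
      _ = b := by ring

lemma ratioCoeff_succ_le (hx0 : 0 ≤ x) (hx : x ≤ 1) (hθ : 0 ≤ θ) (hθ1 : θ ≤ 1) (m : ℕ) :
    ratioCoeff x θ (m + 1) ≤ ratioCoeff x θ m := by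
  have hd := ratioCoeff_diff hx0 hx hθ m
  have ha := ratioCoeff_aux hx0 hx hθ hθ1 m
  refine le_of_mul_le_mul_left (a := (m : ℝ) + 1) ?_ (by positivity)
  linarith

lemma ratioCoeff_antitone (hx0 : 0 ≤ x) (hx : x ≤ 1) (hθ : 0 ≤ θ) (hθ1 : θ ≤ 1) :
    Antitone (ratioCoeff x θ) :=
  antitone_nat_of_succ_le (ratioCoeff_succ_le hx0 hx hθ hθ1)

lemma ratioCoeff_sub_succ_le (hx0 : 0 ≤ x) (hx : x ≤ 1) (hθ : 0 ≤ θ) (m : ℕ) :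
    ((m : ℝ) + 1) * (ratioCoeff x θ m - ratioCoeff x θ (m + 1)) ≤ ratioCoeff x θ m := by
  have hd := ratioCoeff_diff hx0 hx hθ m
  have h0 : 0 ≤ θ * (1 - x) * ∑ k ∈ range (m + 1), x ^ k * ratioCoeff x θ (m - k) :=
    mul_nonneg (mul_nonneg hθ (by linarith)) (sum_nonneg fun k _ =>
      mul_nonneg (pow_nonneg hx0 k) (ratioCoeff_nonneg hx0 hx hθ _))
  linarith

/-- Differences with lag `t` of the coefficients decay like `1 / m`. -/
lemma ratioCoeff_sub_le (hx0 : 0 ≤ x) (hx : x ≤ 1) (hθ : 0 ≤ θ) (hθ1 : θ ≤ 1) (m t : ℕ) :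
    ((m : ℝ) + 1) * (ratioCoeff x θ m - ratioCoeff x θ (m + t)) ≤
      ∑ i ∈ range t, ratioCoeff x θ i := by
  have hanti := ratioCoeff_antitone hx0 hx hθ hθ1
  have h1 : ratioCoeff x θ m - ratioCoeff x θ (m + t) =
      ∑ i ∈ range t, (ratioCoeff x θ (m + i) - ratioCoeff x θ (m + i + 1)) := by
    exact (sum_range_sub' (fun i => ratioCoeff x θ (m + i)) t).symm
  rw [h1, mul_sum]
  -- The unit difference at `m + i` is at most `A_{m+i} / (m+i+1)`, and monotonicity replaces this
  -- by `A_i / (m+1)`.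
  refine sum_le_sum fun i hi => ?_
  have hi' : i ≤ m + i := by omega
  have h2 := ratioCoeff_sub_succ_le hx0 hx hθ (m + i)
  have h3 : 0 ≤ ratioCoeff x θ (m + i) - ratioCoeff x θ (m + i + 1) := by
    linarith [ratioCoeff_succ_le hx0 hx hθ hθ1 (m + i)]
  have h4 := hanti hi'
  push_cast at h2
  nlinarith [Nat.cast_nonneg (α := ℝ) i]

lemma sum_ratioCoeff_le (hx0 : 0 ≤ x) (hx : x ≤ 1) (hθ : 0 ≤ θ) {t : ℕ} (ht : 1 ≤ t) :
    ∑ i ∈ range t, ratioCoeff x θ i ≤ 3 * (1 + t * (1 - x)) ^ θ := by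
  have h0 := defl_nonneg (e := fun _ => θ) (fun _ => hθ) hx0 hx
  have hD := defl_le (e := fun _ => θ) (fun _ => hθ) (fun _ => le_rfl) hx0
  have hr1 := rad_lt_one ht
  have hr0 := (rad_pos t).le
  have hxr : x * rad t ≤ rad t := mul_le_of_le_one_left hr0 hx
  have h1 : ∑ i ∈ range t, ratioCoeff x θ i ≤ 3 * genReal (defl x fun _ => θ) (rad t) :=
    (sum_le_sum_of_subset_of_nonneg (range_subset_range.2 (by omega))
      fun m _ _ => genCoeff_nonneg h0 hD m).trans (sum_genCoeff_le h0 hD ht)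
  have h2 := genReal_defl_mul (e := fun _ => θ) (fun _ => hθ) (fun _ => le_rfl) hx0 hx hr0 hr1
  have h3 := genReal_le_mul_rpow (e := fun _ => θ) (D := |θ|) (s := θ) (fun _ => le_rfl)
    (fun _ => le_rfl) (mul_nonneg hx0 hr0) hxr hr1
  rw [← h2, mul_comm] at h3
  have h4 := le_of_mul_le_mul_left h3 (genReal_pos _ _)
  have h5 : ((1 - x * rad t) / (1 - rad t)) ^ θ ≤ (1 + t * (1 - x)) ^ θ :=
    Real.rpow_le_rpow (div_nonneg (by linarith) (by linarith)) (one_sub_mul_rad_div_le ht hx) hθ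
  linarith

end Binomial

/-! ### Lagged differences of the coefficients of `p(z) / p(xz)`. -/

section Smoothness

variable {e : ℕ → ℝ} {D : ℕ} {x θ : ℝ}

lemma abs_defl_const_le (hx0 : 0 ≤ x) (hx : x ≤ 1) (hθ : 0 ≤ θ) (k : ℕ) :
    |defl x (fun _ => θ) (k + 1)| ≤ θ :=
  abs_le_of_nonneg_of_le (defl_nonneg (fun _ => hθ) hx0 hx)
    (defl_le (fun _ => hθ) (fun _ => le_rfl) hx0) k

lemma sub_const_nonneg (hθe : ∀ k, θ ≤ e (k + 1)) (k : ℕ) : 0 ≤ e (k + 1) - θ := by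
  linarith [hθe k]

lemma sub_const_le (hθ : 0 ≤ θ) (hD : ∀ k, e (k + 1) ≤ D) (k : ℕ) : e (k + 1) - θ ≤ D := by
  linarith [hD k]

lemma genCoeff_defl_eq_ratio (hx0 : 0 ≤ x) (hx : x ≤ 1) (hθ : 0 ≤ θ)
    (hθe : ∀ k, θ ≤ e (k + 1)) (hD : ∀ k, e (k + 1) ≤ D) (n : ℕ) :
    genCoeff (defl x e) n = ∑ i ∈ range (n + 1),
      ratioCoeff x θ i * genCoeff (defl x fun k => e k - θ) (n - i) := by
  have h1 := abs_le_of_nonneg_of_le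
    (defl_nonneg (e := fun k => e k - θ) (sub_const_nonneg hθe) hx0 hx)
    (defl_le (e := fun k => e k - θ) (sub_const_nonneg hθe) (sub_const_le hθ hD) hx0)
  simp only [ratioCoeff]
  rw [← genCoeff_add (abs_defl_const_le hx0 hx hθ) h1]
  congr 1
  funext k
  simp only [defl]; ring

lemma genReal_defl_eq_ratio (hx0 : 0 ≤ x) (hx : x ≤ 1) (hθ : 0 ≤ θ)
    (hθe : ∀ k, θ ≤ e (k + 1)) (hD : ∀ k, e (k + 1) ≤ D) {y : ℝ} (hy0 : 0 ≤ y) (hy : y < 1) :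
    genReal (defl x e) y =
      genReal (defl x fun _ => θ) y * genReal (defl x fun k => e k - θ) y := by
  have h1 := abs_le_of_nonneg_of_le
    (defl_nonneg (e := fun k => e k - θ) (sub_const_nonneg hθe) hx0 hx)
    (defl_le (e := fun k => e k - θ) (sub_const_nonneg hθe) (sub_const_le hθ hD) hx0)
  rw [← genReal_add (abs_defl_const_le hx0 hx hθ) h1 hy0 hy]
  congr 1
  funext k
  simp only [defl]; ring

/-- The coefficients of `((1 - x z) / (1 - z)) ^ θ` shifted by `t`. -/
noncomputable def shiftRatio (x θ : ℝ) (t i : ℕ) : ℝ := if t ≤ i then ratioCoeff x θ (i - t) else 0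

/-- Monotonicity fixes the sign of every difference past index `t`, so these telescope to at most
the sum of the first `t` coefficients; the indices below `t` contribute that sum once more. -/
lemma sum_abs_ratioCoeff_sub_shift_le (hx0 : 0 ≤ x) (hx : x ≤ 1) (hθ : 0 ≤ θ) (hθ1 : θ ≤ 1)
    (t M : ℕ) : ∑ i ∈ range (t + M), |ratioCoeff x θ i - shiftRatio x θ t i| ≤
      2 * ∑ i ∈ range t, ratioCoeff x θ i := by
  have hanti := ratioCoeff_antitone hx0 hx hθ hθ1
  have hnn := ratioCoeff_nonneg hx0 hx hθ
  rw [sum_range_add]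
  have h1 : ∑ i ∈ range t, |ratioCoeff x θ i - shiftRatio x θ t i| =
      ∑ i ∈ range t, ratioCoeff x θ i := by
    refine sum_congr rfl fun i hi => ?_
    rw [shiftRatio, if_neg (by simpa using hi), sub_zero, abs_of_nonneg (hnn i)]
  have h2 : ∑ i ∈ range M, |ratioCoeff x θ (t + i) - shiftRatio x θ t (t + i)| =
      ∑ i ∈ range M, ratioCoeff x θ i - ∑ i ∈ range M, ratioCoeff x θ (t + i) := by
    rw [← sum_sub_distrib]
    refine sum_congr rfl fun i _ => ?_
    rw [shiftRatio, if_pos (by omega), Nat.add_sub_cancel_left, abs_sub_comm, abs_of_nonneg]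
    linarith [hanti (by omega : i ≤ t + i)]
  have h3 : ∑ i ∈ range M, ratioCoeff x θ i ≤ ∑ i ∈ range (t + M), ratioCoeff x θ i :=
    sum_le_sum_of_subset_of_nonneg (range_subset_range.2 (by omega)) fun i _ _ => hnn i
  rw [sum_range_add] at h3
  rw [h1, h2]
  linarith

/-- In the convolution of `A` with the cofactor `κ`, the two halves are treated differently. For `i
≤ n/2` the index `N - i` is at least `3n/8`, so `κ_{N-i} = O(K/n)` and the `ℓ¹` bound on the shifted
differences of `A` applies. For `i > n/2` those differences are pointwise `O(T/n)`, and the sum of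
`κ` is `O(K)`. -/
lemma abs_genCoeff_defl_sub_le (hx0 : 0 ≤ x) (hx : x ≤ 1) (hθ : 0 ≤ θ) (hθ1 : θ ≤ 1)
    (hθe : ∀ k, θ ≤ e (k + 1)) (hD : ∀ k, e (k + 1) ≤ D) {n N t : ℕ} (hn : 1 ≤ n) (hNn : N ≤ n)
    (hN : 7 * n ≤ 8 * N) (ht : 8 * t ≤ n) :
    |genCoeff (defl x e) N - genCoeff (defl x e) (N - t)| ≤
      (16 * D + 8) / n * genReal (defl x fun k => e k - θ) (rad n) *
        ∑ i ∈ range t, ratioCoeff x θ i := by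
  set κ : ℕ → ℝ := genCoeff (defl x fun k => e k - θ) with hκ
  set K := genReal (defl x fun k => e k - θ) (rad n) with hK
  set T := ∑ i ∈ range t, ratioCoeff x θ i with hT
  have hn0 : (0 : ℝ) < n := by exact_mod_cast hn
  have f0 := defl_nonneg (e := fun k => e k - θ) (sub_const_nonneg hθe) hx0 hx
  have fD := defl_le (e := fun k => e k - θ) (sub_const_nonneg hθe) (sub_const_le hθ hD) hx0
  have hκ0 : ∀ i, 0 ≤ κ i := genCoeff_nonneg f0 fD
  have hK0 : 0 < K := genReal_pos _ _
  have hA0 := ratioCoeff_nonneg hx0 hx hθ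
  have hT0 : 0 ≤ T := sum_nonneg fun i _ => hA0 i
  have hsumκ : ∑ i ∈ range (N + 1), κ (N - i) ≤ 3 * K := by
    have := sum_range_reflect κ (N + 1)
    simp only [Nat.add_sub_cancel] at this
    rw [this]
    refine (sum_le_sum_of_subset_of_nonneg (range_subset_range.2 (by omega))
      fun i _ _ => hκ0 i).trans (sum_genCoeff_le f0 fD hn)
  have hshift : genCoeff (defl x e) (N - t) =
      ∑ i ∈ range (N + 1), shiftRatio x θ t i * κ (N - i) := by
    have hz : ∑ i ∈ range t, shiftRatio x θ t i * κ (N - i) = 0 := by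
      refine sum_eq_zero fun i hi => ?_
      rw [shiftRatio, if_neg (by simpa using hi), zero_mul]
    have hsplit := sum_range_add (fun i => shiftRatio x θ t i * κ (N - i)) t (N - t + 1)
    rw [hz, zero_add, show t + (N - t + 1) = N + 1 by omega] at hsplit
    rw [hsplit, genCoeff_defl_eq_ratio hx0 hx hθ hθe hD]
    refine sum_congr rfl fun i _ => ?_
    rw [shiftRatio, if_pos (by omega), Nat.add_sub_cancel_left, Nat.sub_sub]
  have hsumA : ∑ i ∈ range (N + 1), |ratioCoeff x θ i - shiftRatio x θ t i| ≤ 2 * T := by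
    have := sum_abs_ratioCoeff_sub_shift_le hx0 hx hθ hθ1 t (N + 1 - t)
    rwa [show t + (N + 1 - t) = N + 1 by omega] at this
  have hterm : ∀ i ∈ range (N + 1), |(ratioCoeff x θ i - shiftRatio x θ t i) * κ (N - i)| ≤
      8 * D * K / n * |ratioCoeff x θ i - shiftRatio x θ t i| + 8 / 3 * T / n * κ (N - i) := by
    intro i hi
    have hiN : i ≤ N := by simpa [Nat.lt_succ_iff] using hi
    rw [abs_mul, abs_of_nonneg (hκ0 _)]
    by_cases h : 2 * i ≤ n
    · have h1 := mul_genCoeff_le f0 fD hn (show N - i ≤ n by omega)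
      have h2 : (3 * n : ℝ) ≤ 8 * (N - i : ℕ) := by
        have : 3 * n ≤ 8 * (N - i) := by omega
        exact_mod_cast this
      have h3 : κ (N - i) ≤ 8 * D * K / n := by
        rw [le_div_iff₀ hn0]
        have := mul_le_mul_of_nonneg_right h2 (hκ0 (N - i))
        simp only [← hκ, ← hK] at h1
        linarith
      have h4 : 0 ≤ 8 / 3 * T / n * κ (N - i) := by have := hκ0 (N - i); positivity
      have := mul_le_mul_of_nonneg_left h3 (abs_nonneg (ratioCoeff x θ i - shiftRatio x θ t i))
      linarith
    · have hti : t ≤ i := by omega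
      have h1 := ratioCoeff_sub_le hx0 hx hθ hθ1 (i - t) t
      rw [Nat.sub_add_cancel hti] at h1
      have h2 : (3 * n : ℝ) ≤ 8 * (((i - t : ℕ) : ℝ) + 1) := by
        have : 3 * n ≤ 8 * ((i - t) + 1) := by omega
        exact_mod_cast this
      have h3 : 0 ≤ ratioCoeff x θ (i - t) - ratioCoeff x θ i := by
        linarith [ratioCoeff_antitone hx0 hx hθ hθ1 (by omega : i - t ≤ i)]
      have h4 : |ratioCoeff x θ i - shiftRatio x θ t i| ≤ 8 / 3 * T / n := by
        rw [shiftRatio, if_pos hti, abs_sub_comm, abs_of_nonneg h3, le_div_iff₀ hn0]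
        have := mul_le_mul_of_nonneg_right h2 h3
        linarith
      have h5 : 0 ≤ 8 * D * K / n * |ratioCoeff x θ i - shiftRatio x θ t i| := by positivity
      have := mul_le_mul_of_nonneg_right h4 (hκ0 (N - i))
      linarith
  have hdiff : genCoeff (defl x e) N - genCoeff (defl x e) (N - t) =
      ∑ i ∈ range (N + 1), (ratioCoeff x θ i - shiftRatio x θ t i) * κ (N - i) := by
    rw [hshift, genCoeff_defl_eq_ratio hx0 hx hθ hθe hD, ← sum_sub_distrib]
    exact sum_congr rfl fun i _ => (sub_mul _ _ _).symm
  rw [hdiff]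
  refine (abs_sum_le_sum_abs _ _).trans ((sum_le_sum hterm).trans ?_)
  rw [sum_add_distrib, ← mul_sum, ← mul_sum]
  calc _ ≤ 8 * D * K / n * (2 * T) + 8 / 3 * T / n * (3 * K) := by gcongr
    _ = _ := by ring

end Smoothness

/-! ### Comparison of `h_{n-j}(x)` with `p_n / p(x)`. -/

section Pointwise

variable {e : ℕ → ℝ} {D : ℕ} {x θ : ℝ}

lemma genReal_defl_rad_mul_le (h0 : ∀ k, 0 ≤ e (k + 1)) (hD : ∀ k, e (k + 1) ≤ D) (hx0 : 0 ≤ x)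
    {n : ℕ} (hn : 1 ≤ n) (hxr : x ≤ rad n) :
    genReal (defl x e) (rad n) * genReal e x ≤ 2 ^ D * genReal e (rad n) := by
  have hr0 := (rad_pos n).le
  have hr1 := rad_lt_one hn
  have hx1 : x < 1 := hxr.trans_lt hr1
  have h1 := genReal_defl_mul h0 hD hx0 hx1.le hr0 hr1
  have hle : x * rad n ≤ x := mul_le_of_le_one_right hx0 hr1.le
  have h2 := genReal_le_mul_rpow (abs_le_of_nonneg_of_le h0 hD) hD (mul_nonneg hx0 hr0) hle hx1
  rw [Real.rpow_natCast] at h2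
  have h3 : (1 - x * rad n) / (1 - x) ≤ 2 := by
    rw [div_le_iff₀ (by linarith)]; nlinarith
  have h4 : ((1 - x * rad n) / (1 - x)) ^ D ≤ 2 ^ D :=
    pow_le_pow_left₀ (div_nonneg (by linarith) (by linarith)) h3 D
  have hp := genReal_pos (defl x e) (rad n)
  have hq := genReal_pos e (x * rad n)
  calc genReal (defl x e) (rad n) * genReal e x
      ≤ genReal (defl x e) (rad n) * (genReal e (x * rad n) * 2 ^ D) := by
        gcongr
        exact h2.trans (by gcongr)
    _ = 2 ^ D * genReal e (rad n) := by rw [← h1]; ring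

lemma rpow_le_genReal_defl_const (hθ : 0 ≤ θ) (hx0 : 0 ≤ x) {n : ℕ} (hn : 1 ≤ n)
    (hxr : x ≤ rad n) : (n * (1 - x)) ^ θ ≤ genReal (defl x fun _ => θ) (rad n) := by
  have hr0 := (rad_pos n).le
  have hr1 := rad_lt_one hn
  have hx1 : x < 1 := hxr.trans_lt hr1
  have hn0 : (0 : ℝ) < n := by exact_mod_cast hn
  have h1 := genReal_defl_mul (e := fun _ => θ) (fun _ => hθ) (fun _ => le_rfl) hx0 hx1.le hr0 hr1
  have h2 := mul_rpow_le_genReal (e := fun _ => θ) (D := |θ|) (s := θ) (fun _ => le_rfl)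
    (fun _ => le_rfl) (mul_nonneg hx0 hr0) (mul_le_of_le_one_left hr0 hx1.le) hr1
  rw [← h1, mul_comm] at h2
  refine le_trans ?_ (le_of_mul_le_mul_right h2 (genReal_pos _ _))
  refine Real.rpow_le_rpow (mul_nonneg hn0.le (by linarith)) ?_ hθ
  rw [le_div_iff₀ (by linarith)]
  have h3 : n * (1 - rad n) ≤ 1 := by
    have := mul_le_mul_of_nonneg_left (one_sub_rad_le n) hn0.le
    rwa [mul_one_div_cancel hn0.ne'] at this
  have h4 : x * rad n ≤ x := mul_le_of_le_one_right hx0 hr1.le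
  nlinarith

/-- The factor split off is at least `(n (1 - x))^θ` at `e^{-1/n}`; dividing by it produces the
decay in the pointwise estimate. -/
lemma genReal_sub_const_mul_le (hθ : 0 ≤ θ) (hθe : ∀ k, θ ≤ e (k + 1))
    (hD : ∀ k, e (k + 1) ≤ D) (hx0 : 0 ≤ x) {n : ℕ} (hn : 1 ≤ n) (hxr : x ≤ rad n) :
    genReal (defl x fun k => e k - θ) (rad n) * genReal e x ≤
      2 ^ D * genReal e (rad n) / (n * (1 - x)) ^ θ := by
  have hr1 := rad_lt_one hn
  have hx1 : x < 1 := hxr.trans_lt hr1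
  have hn0 : (0 : ℝ) < n := by exact_mod_cast hn
  have h1 := genReal_defl_rad_mul_le (fun k => hθ.trans (hθe k)) hD hx0 hn hxr
  rw [genReal_defl_eq_ratio hx0 hx1.le hθ hθe hD (rad_pos n).le hr1] at h1
  have h2 := rpow_le_genReal_defl_const hθ hx0 hn hxr
  have hpos : 0 < (n * (1 - x)) ^ θ := Real.rpow_pos_of_pos (mul_pos hn0 (by linarith)) _
  rw [le_div_iff₀ hpos]
  refine le_trans ?_ h1
  have := mul_le_mul_of_nonneg_right h2
    (mul_pos (genReal_pos (defl x fun k => e k - θ) (rad n)) (genReal_pos e x)).le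
  linarith

lemma one_sub_mul_sum_identity (p : ℕ → ℝ) (x : ℝ) (M : ℕ) :
    (1 - x) * ∑ m ∈ range M, (∑ i ∈ range m, p i) * x ^ m + (∑ i ∈ range M, p i) * x ^ M =
      x * ∑ m ∈ range M, p m * x ^ m := by
  induction M with
  | zero => simp
  | succ M ih =>
    rw [sum_range_succ _ M, sum_range_succ (fun m => p m * x ^ m), mul_add x, ← ih,
      sum_range_succ p, pow_succ]
    ring

/-- The recurrence bounds `m p_m` by `D` times a partial sum of the coefficients, and Abel summation
bounds `(1 - x) ∑ (partial sum) x^m` by `p(x)`. -/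
lemma sum_mul_genCoeff_mul_pow_le (h0 : ∀ k, 0 ≤ e (k + 1)) (hD : ∀ k, e (k + 1) ≤ D)
    (hx0 : 0 ≤ x) (hx : x < 1) (M : ℕ) :
    ∑ m ∈ range M, genCoeff e m * x ^ m * (1 + m * (1 - x)) ≤ (1 + D) * genReal e x := by
  have hp := genCoeff_nonneg h0 hD
  have hs := sum_genCoeff_mul_pow_le h0 hD hx0 hx (range M)
  have hid := one_sub_mul_sum_identity (genCoeff e) x M
  have hlast : 0 ≤ (∑ i ∈ range M, genCoeff e i) * x ^ M :=
    mul_nonneg (sum_nonneg fun i _ => hp i) (pow_nonneg hx0 M)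
  have hs0 : 0 ≤ ∑ m ∈ range M, genCoeff e m * x ^ m :=
    sum_nonneg fun i _ => mul_nonneg (hp i) (pow_nonneg hx0 i)
  have h1 : ∑ m ∈ range M, genCoeff e m * x ^ m * (1 + m * (1 - x)) ≤
      ∑ m ∈ range M, (genCoeff e m * x ^ m +
        D * ((1 - x) * ((∑ i ∈ range m, genCoeff e i) * x ^ m))) := by
    refine sum_le_sum fun m _ => ?_
    have h2 := mul_genCoeff_le_sum h0 hD (n := m) (B := D) fun k _ => hD k
    have h3 := mul_le_mul_of_nonneg_right h2
      (mul_nonneg (pow_nonneg hx0 m) (by linarith : 0 ≤ 1 - x))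
    linarith
  rw [sum_add_distrib, ← mul_sum, ← mul_sum] at h1
  have h4 : (1 - x) * ∑ m ∈ range M, (∑ i ∈ range m, genCoeff e i) * x ^ m ≤ genReal e x := by
    nlinarith
  have := mul_le_mul_of_nonneg_left h4 (Nat.cast_nonneg (α := ℝ) D)
  linarith

/-- Applied with `u = n (1 - x)`: the exponential, coming from indices beyond `n/8`, absorbs all
polynomial losses. -/
lemma rpow_mul_pow_mul_exp_le (D : ℕ) {θ u : ℝ} (hθ : 0 ≤ θ) (hθ1 : θ ≤ 1) (hu : 0 ≤ u) :
    u ^ θ * ((1 + u) ^ D * Real.exp (-u / 16)) ≤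
      Real.exp (1 / 16) * 16 ^ (D + 1) * (D + 1).factorial := by
  have h1 : u ^ θ ≤ 1 + u :=
    (Real.rpow_le_rpow hu (by linarith : u ≤ 1 + u) hθ).trans
      ((Real.rpow_le_rpow_of_exponent_le (by linarith) hθ1).trans (by rw [Real.rpow_one]))
  have h2 := Real.pow_div_factorial_le_exp ((1 + u) / 16) (by positivity) (D + 1)
  rw [div_le_iff₀ (by positivity), div_pow, div_le_iff₀ (by positivity)] at h2
  have h3 : Real.exp ((1 + u) / 16) * Real.exp (-u / 16) = Real.exp (1 / 16) := by
    rw [← Real.exp_add]; congr 1; ring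
  calc u ^ θ * ((1 + u) ^ D * Real.exp (-u / 16))
      ≤ (1 + u) * ((1 + u) ^ D * Real.exp (-u / 16)) := by gcongr
    _ = (1 + u) ^ (D + 1) * Real.exp (-u / 16) := by ring
    _ ≤ Real.exp ((1 + u) / 16) * (D + 1).factorial * 16 ^ (D + 1) * Real.exp (-u / 16) := by
        gcongr
    _ = _ := by rw [← h3]; ring

lemma sqrt_pow_le_exp (hx0 : 0 ≤ x) (hx : x ≤ 1) {n M : ℕ} (hM : n ≤ 8 * M) :
    Real.sqrt x ^ M ≤ Real.exp (-(n * (1 - x)) / 16) := by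
  set s := Real.sqrt x
  have hs0 : 0 ≤ s := Real.sqrt_nonneg x
  have hs2 : s ^ 2 = x := Real.sq_sqrt hx0
  have hs1 : s ≤ 1 := Real.sqrt_le_one.2 hx
  have hM' : (n : ℝ) ≤ 8 * M := by exact_mod_cast hM
  have h1 : s ≤ Real.exp (s - 1) := by linarith [Real.add_one_le_exp (s - 1)]
  calc s ^ M ≤ Real.exp (s - 1) ^ M := pow_le_pow_left₀ hs0 h1 M
    _ = Real.exp (M * (s - 1)) := by rw [← Real.exp_nat_mul]
    _ ≤ _ := by
      rw [Real.exp_le_exp]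
      have h2 : (1 - x) / 2 ≤ 1 - s := by nlinarith
      have h3 := mul_le_mul_of_nonneg_left h2 (Nat.cast_nonneg (α := ℝ) M)
      have h4 := mul_le_mul_of_nonneg_right hM' (by linarith : 0 ≤ 1 - x)
      linarith

lemma one_add_lag_rpow_le {y θ : ℝ} (hy : 0 ≤ y) (hθ : 0 ≤ θ) (hθ1 : θ ≤ 1) {t j m : ℕ}
    (ht : t ≤ m + j) : (1 + t * y) ^ θ ≤ (1 + j * y) ^ θ * (1 + m * y) := by
  have ht' : (t : ℝ) ≤ m + j := by exact_mod_cast ht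
  have h1 : 1 + t * y ≤ (1 + j * y) * (1 + m * y) := by
    have := mul_le_mul_of_nonneg_right ht' hy
    have h2 : 0 ≤ (j * y) * (m * y) := by positivity
    linarith
  calc (1 + t * y) ^ θ ≤ ((1 + j * y) * (1 + m * y)) ^ θ :=
        Real.rpow_le_rpow (by positivity) h1 hθ
    _ = (1 + j * y) ^ θ * (1 + m * y) ^ θ := Real.mul_rpow (by positivity) (by positivity)
    _ ≤ (1 + j * y) ^ θ * (1 + m * y) := by
        gcongr
        refine (Real.rpow_le_rpow_of_exponent_le ?_ hθ1).trans (by rw [Real.rpow_one])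
        have : 0 ≤ m * y := by positivity
        linarith

lemma abs_genCoeff_defl_lag_le (hx0 : 0 ≤ x) (hx : x ≤ 1) (hθ : 0 ≤ θ) (hθ1 : θ ≤ 1)
    (hθe : ∀ k, θ ≤ e (k + 1)) (hD : ∀ k, e (k + 1) ≤ D) {n j m : ℕ} (hn : 1 ≤ n)
    (hj : 8 * j ≤ n) (hm : 8 * m ≤ n) :
    |genCoeff (defl x e) (n - m) - genCoeff (defl x e) (n - j)| ≤
      (16 * D + 8) / n * genReal (defl x fun k => e k - θ) (rad n) *
        (3 * ((1 + j * (1 - x)) ^ θ * (1 + m * (1 - x)))) := by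
  have hy : 0 ≤ 1 - x := by linarith
  have hK := genReal_pos (defl x fun k => e k - θ) (rad n)
  have main : ∀ a b : ℕ, a ≤ b → 8 * b ≤ n →
      |genCoeff (defl x e) (n - a) - genCoeff (defl x e) (n - b)| ≤
      (16 * D + 8) / n * genReal (defl x fun k => e k - θ) (rad n) *
        ∑ i ∈ range (b - a), ratioCoeff x θ i := by
    intro a b hab hb
    have := abs_genCoeff_defl_sub_le hx0 hx hθ hθ1 hθe hD hn (N := n - a) (t := b - a)
      (by omega) (by omega) (by omega)
    rwa [show n - a - (b - a) = n - b by omega] at this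
  have hsum : ∀ t : ℕ, t ≤ m + j → ∑ i ∈ range t, ratioCoeff x θ i ≤
      3 * ((1 + j * (1 - x)) ^ θ * (1 + m * (1 - x))) := by
    intro t ht
    rcases Nat.eq_zero_or_pos t with rfl | htpos
    · simp only [range_zero, sum_empty]; positivity
    · exact (sum_ratioCoeff_le hx0 hx hθ htpos).trans
        (mul_le_mul_of_nonneg_left (one_add_lag_rpow_le hy hθ hθ1 ht) (by norm_num))
  rcases le_total m j with h | h
  · refine (main m j h hj).trans (mul_le_mul_of_nonneg_left (hsum _ (by omega)) (by positivity))
  · rw [abs_sub_comm]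
    refine (main j m h hm).trans (mul_le_mul_of_nonneg_left (hsum _ (by omega)) (by positivity))

/-- The coefficient of `z ^ (n - j)` in `p(z) / p(x z)` is close to `p_n / p(x)`. -/
lemma exists_abs_genCoeff_sub_le (D : ℕ) : ∃ C : ℝ, 0 < C ∧ ∀ (e : ℕ → ℝ) (θ : ℝ), 0 ≤ θ → θ ≤ 1 →
    (∀ k, θ ≤ e (k + 1)) → (∀ k, e (k + 1) ≤ D) → ∀ n j : ℕ, 1 ≤ n → 8 * j ≤ n →
    ∀ x : ℝ, 0 ≤ x → x ≤ rad n →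
    |genCoeff e n - genReal e x * genCoeff (defl x e) (n - j)| ≤
      C * (genReal e (rad n) / n) * ((1 + j * (1 - x)) ^ θ / (n * (1 - x)) ^ θ) := by
  set C₁ : ℝ := Real.exp (1 / 16) * 16 ^ (D + 1) * (D + 1).factorial with hC₁
  have hC₁0 : 0 < C₁ := by positivity
  refine ⟨(16 * D + 8) * 3 * (1 + D) * 2 ^ D + (72 * D + 6 * D * 2 ^ D) * C₁, by positivity, ?_⟩
  intro e θ hθ hθ1 hθe hD n j hn hj x hx0 hxr
  have h0 : ∀ k, 0 ≤ e (k + 1) := fun k => hθ.trans (hθe k)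
  have hr1 := rad_lt_one hn
  have hx1 : x < 1 := hxr.trans_lt hr1
  have hn0 : (0 : ℝ) < n := by exact_mod_cast hn
  have hy : 0 < 1 - x := by linarith
  have hp := genCoeff_nonneg h0 hD
  have d0 := defl_nonneg h0 hx0 hx1.le
  have dD := defl_le h0 hD hx0
  have hh := genCoeff_nonneg d0 dD
  set h : ℕ → ℝ := genCoeff (defl x e) with hh_def
  set H := genReal (defl x e) (rad n) with hH
  set K := genReal (defl x fun k => e k - θ) (rad n) with hK
  set R := genReal e (rad n) with hR
  set P := genReal e x with hP
  set J := (1 + j * (1 - x)) ^ θ with hJ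
  set U := (n * (1 - x)) ^ θ with hU
  set ε := Real.exp (-(n * (1 - x)) / 16) with hε
  have hU0 : 0 < U := Real.rpow_pos_of_pos (mul_pos hn0 hy) _
  have hJ1 : 1 ≤ J := Real.one_le_rpow (by have : 0 ≤ j * (1 - x) := by positivity
                                           linarith) hθ
  have hR0 : 0 < R := genReal_pos _ _
  have hP0 : 0 < P := genReal_pos _ _
  have hH0 : 0 < H := genReal_pos _ _
  have hK0 : 0 < K := genReal_pos _ _
  have hε0 : 0 < ε := Real.exp_pos _
  have hPR : P ≤ R := genReal_mono h0 hD hx0 hxr hr1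
  -- With this cut, `m < M` is equivalent to `8m ≤ n`, the range of the lag estimate.
  set M := n / 8 + 1 with hM
  have hMn : n ≤ 8 * M := by omega
  have hMn' : M ≤ n + 1 := by omega
  have hsM := sqrt_pow_le_exp hx0 hx1.le hMn
  have hxM : ∀ m, M ≤ m → x ^ m ≤ ε := by
    intro m hm
    refine le_trans ?_ hsM
    calc x ^ m ≤ x ^ M := pow_le_pow_of_le_one hx0 hx1.le hm
      _ ≤ Real.sqrt x ^ M := pow_le_pow_left₀ hx0 (Real.le_sqrt_of_sq_le (by nlinarith)) M
  -- The tail bound is used with `s = √x`, so that `s^2 = x`.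
  have htail : P - ∑ m ∈ range M, genCoeff e m * x ^ m ≤ 2 ^ D * ε * P := by
    have := genReal_sub_sum_le h0 hD (Real.sqrt_nonneg x)
      ((Real.sqrt_lt' one_pos).2 (by simpa using hx1)) M
    rw [Real.sq_sqrt hx0] at this
    refine this.trans ?_
    gcongr
  have htail0 : 0 ≤ P - ∑ m ∈ range M, genCoeff e m * x ^ m := by
    linarith [sum_genCoeff_mul_pow_le h0 hD hx0 hx1 (range M)]
  have hT1 : |∑ m ∈ range M, genCoeff e m * x ^ m * (h (n - m) - h (n - j))| ≤
      (16 * D + 8) * 3 * (1 + D) * 2 ^ D * (R / n) * (J / U) := by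
    have hterm : ∀ m ∈ range M, |genCoeff e m * x ^ m * (h (n - m) - h (n - j))| ≤
        (16 * D + 8) / n * K * 3 * J * (genCoeff e m * x ^ m * (1 + m * (1 - x))) := by
      intro m hm
      have hm' : 8 * m ≤ n := by have := mem_range.1 hm; omega
      have := abs_genCoeff_defl_lag_le hx0 hx1.le hθ hθ1 hθe hD hn hj hm'
      have hpm : 0 ≤ genCoeff e m * x ^ m := mul_nonneg (hp m) (pow_nonneg hx0 m)
      rw [abs_mul, abs_of_nonneg hpm]
      refine (mul_le_mul_of_nonneg_left this hpm).trans (le_of_eq ?_)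
      ring
    refine (abs_sum_le_sum_abs _ _).trans ((sum_le_sum hterm).trans ?_)
    rw [← mul_sum]
    have hm1 := sum_mul_genCoeff_mul_pow_le h0 hD hx0 hx1 M
    have hm2 := genReal_sub_const_mul_le hθ hθe hD hx0 hn hxr
    calc _ ≤ (16 * D + 8) / n * K * 3 * J * ((1 + D) * P) := by gcongr
      _ = (16 * D + 8) / n * 3 * J * (1 + D) * (K * P) := by ring
      _ ≤ (16 * D + 8) / n * 3 * J * (1 + D) * (2 ^ D * R / U) := by gcongr
      _ = _ := by ring
  have hHε : H * ε ≤ C₁ / U := by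
    rw [le_div_iff₀ hU0]
    have h1 := genReal_defl_rad_le h0 hD hx0 hx1.le hn
    have h2 := rpow_mul_pow_mul_exp_le D hθ hθ1 (mul_nonneg hn0.le hy.le)
    refine le_trans ?_ h2
    rw [mul_comm]
    gcongr
  have hT2 : |∑ i ∈ range (n + 1 - M), genCoeff e (M + i) * x ^ (M + i) * h (n - (M + i))| ≤
      72 * D * (R / n) * (C₁ / U) := by
    have hterm : ∀ i ∈ range (n + 1 - M),
        genCoeff e (M + i) * x ^ (M + i) * h (n - (M + i)) ≤
          24 * D * (R / n) * ε * h (n - M - i) := by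
      intro i hi
      have hi' : M + i ≤ n := by have := mem_range.1 hi; omega
      have h1 := mul_genCoeff_le h0 hD hn hi'
      have h2 : (n : ℝ) ≤ 8 * ((M + i : ℕ) : ℝ) := by
        have : n ≤ 8 * (M + i) := by omega
        exact_mod_cast this
      have h3 : genCoeff e (M + i) ≤ 24 * D * (R / n) := by
        rw [← mul_div_assoc, le_div_iff₀ hn0]
        have := mul_le_mul_of_nonneg_right h2 (hp (M + i))
        linarith
      rw [Nat.sub_sub]
      exact mul_le_mul_of_nonneg_right (mul_le_mul h3 (hxM _ (by omega)) (pow_nonneg hx0 _)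
        ((hp _).trans h3)) (hh _)
    have hsum : ∑ i ∈ range (n + 1 - M), h (n - M - i) ≤ 3 * H := by
      have := sum_range_reflect h (n + 1 - M)
      rw [show ∑ i ∈ range (n + 1 - M), h (n - M - i) = ∑ i ∈ range (n + 1 - M),
        h (n + 1 - M - 1 - i) from sum_congr rfl fun i _ => by congr 1; omega, this]
      exact (sum_le_sum_of_subset_of_nonneg (range_subset_range.2 (by omega))
        fun i _ _ => hh i).trans (sum_genCoeff_le d0 dD hn)
    rw [abs_of_nonneg (sum_nonneg fun i _ => mul_nonneg (mul_nonneg (hp _) (pow_nonneg hx0 _))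
      (hh _))]
    refine (sum_le_sum hterm).trans ?_
    rw [← mul_sum]
    calc _ ≤ 24 * D * (R / n) * ε * (3 * H) := by gcongr
      _ = 72 * D * (R / n) * (H * ε) := by ring
      _ ≤ _ := by gcongr
  have hT3 : |(P - ∑ m ∈ range M, genCoeff e m * x ^ m) * h (n - j)| ≤
      6 * D * 2 ^ D * (R / n) * (C₁ / U) := by
    rw [abs_of_nonneg (mul_nonneg htail0 (hh _))]
    have h1 := mul_genCoeff_le d0 dD hn (show n - j ≤ n by omega)
    have h2 : (n : ℝ) ≤ 2 * ((n - j : ℕ) : ℝ) := by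
      have : n ≤ 2 * (n - j) := by omega
      exact_mod_cast this
    have h3 : h (n - j) ≤ 6 * D * H / n := by
      rw [le_div_iff₀ hn0]
      have := mul_le_mul_of_nonneg_right h2 (hh (n - j))
      linarith
    calc _ ≤ (2 ^ D * ε * P) * (6 * D * H / n) :=
          mul_le_mul htail h3 (hh _) (by positivity)
      _ ≤ (2 ^ D * ε * R) * (6 * D * H / n) := by gcongr
      _ = 6 * D * 2 ^ D * (R / n) * (H * ε) := by ring
      _ ≤ _ := by gcongr
  -- Subtract the two expansions for `m < M`; the rest of the sum for `p_n` and the rest of the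
  -- series for `p(x)` are estimated separately.
  have hsplit : genCoeff e n - P * h (n - j) =
      ∑ m ∈ range M, genCoeff e m * x ^ m * (h (n - m) - h (n - j)) +
      ∑ i ∈ range (n + 1 - M), genCoeff e (M + i) * x ^ (M + i) * h (n - (M + i)) -
      (P - ∑ m ∈ range M, genCoeff e m * x ^ m) * h (n - j) := by
    rw [genCoeff_eq_sum_defl h0 hD hx0 hx1.le n]
    have := sum_range_add (fun m => genCoeff e m * x ^ m * h (n - m)) M (n + 1 - M)
    rw [show M + (n + 1 - M) = n + 1 by omega] at this
    rw [this]
    simp only [mul_sub, sum_sub_distrib, ← sum_mul]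
    ring
  rw [hsplit]
  have hCU : C₁ / U ≤ C₁ * (J / U) := by
    rw [← mul_div_assoc]
    gcongr
    nlinarith
  refine (abs_sub _ _).trans ?_
  refine (add_le_add (abs_add_le _ _) le_rfl).trans ?_
  calc _ ≤ (16 * D + 8) * 3 * (1 + D) * 2 ^ D * (R / n) * (J / U) + 72 * D * (R / n) * (C₁ / U) +
        6 * D * 2 ^ D * (R / n) * (C₁ / U) := by gcongr
    _ ≤ (16 * D + 8) * 3 * (1 + D) * 2 ^ D * (R / n) * (J / U) +
        72 * D * (R / n) * (C₁ * (J / U)) + 6 * D * 2 ^ D * (R / n) * (C₁ * (J / U)) := by gcongr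
    _ = _ := by ring

end Pointwise

/-! ### Beta integrals and the integrals of `x^(j-1) / p(x)`. -/

section Integrals

variable {e : ℕ → ℝ} {D : ℕ} {x θ : ℝ}

lemma integral_pow_mul_one_sub_pow_succ (i a : ℕ) :
    ((i : ℝ) + 1) * ∫ x in (0 : ℝ)..1, x ^ i * (1 - x) ^ (a + 1) =
      ((a : ℝ) + 1) * ∫ x in (0 : ℝ)..1, x ^ (i + 1) * (1 - x) ^ a := by
  have hderiv : ∀ x ∈ Set.uIcc (0 : ℝ) 1, HasDerivAt (fun x : ℝ => x ^ (i + 1) * (1 - x) ^ (a + 1))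
      (((i : ℝ) + 1) * (x ^ i * (1 - x) ^ (a + 1)) - ((a : ℝ) + 1) * (x ^ (i + 1) * (1 - x) ^ a))
      x := by
    intro x _
    have h1 := hasDerivAt_pow (i + 1) x
    have h2 := ((hasDerivAt_id x).const_sub 1).pow (a + 1)
    have h3 := h1.mul h2
    refine h3.congr_deriv ?_
    simp only [id, Nat.add_sub_cancel, Pi.pow_apply]
    push_cast
    ring
  have h := intervalIntegral.integral_eq_sub_of_hasDerivAt hderiv
    (Continuous.intervalIntegrable (by fun_prop) _ _)
  rw [intervalIntegral.integral_sub (Continuous.intervalIntegrable (by fun_prop) _ _)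
    (Continuous.intervalIntegrable (by fun_prop) _ _), intervalIntegral.integral_const_mul,
    intervalIntegral.integral_const_mul] at h
  simp only [sub_self, ne_eq, Nat.add_eq_zero_iff, one_ne_zero, and_false, not_false_eq_true,
    zero_pow, mul_zero, zero_mul] at h
  linarith

lemma integral_pow_mul_one_sub_pow_le (i a : ℕ) :
    ∫ x in (0 : ℝ)..1, x ^ i * (1 - x) ^ a ≤ a.factorial / ((i : ℝ) + 1) ^ (a + 1) := by
  induction a with
  | zero => simp [integral_pow]
  | succ a ih =>
    have h1 := integral_pow_mul_one_sub_pow_succ i a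
    have h2 : ∫ x in (0 : ℝ)..1, x ^ (i + 1) * (1 - x) ^ a ≤
        ∫ x in (0 : ℝ)..1, x ^ i * (1 - x) ^ a := by
      refine intervalIntegral.integral_mono_on zero_le_one
        (Continuous.intervalIntegrable (by fun_prop) _ _)
        (Continuous.intervalIntegrable (by fun_prop) _ _) fun x hx => ?_
      exact mul_le_mul_of_nonneg_right (pow_le_pow_of_le_one hx.1 hx.2 (Nat.le_succ i))
        (pow_nonneg (by linarith [hx.2]) a)
    have hi : (0 : ℝ) < (i : ℝ) + 1 := by positivity
    refine le_of_mul_le_mul_left ?_ hi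
    rw [h1]
    calc ((a : ℝ) + 1) * ∫ x in (0 : ℝ)..1, x ^ (i + 1) * (1 - x) ^ a
        ≤ ((a : ℝ) + 1) * (a.factorial / ((i : ℝ) + 1) ^ (a + 1)) := by
          gcongr
          exact h2.trans ih
      _ = _ := by
          rw [Nat.factorial_succ, pow_succ _ (a + 1)]
          push_cast
          field_simp

/-- The weight `x^(j-1)` concentrates where `1 - x` is of order `1/j`: each factor `1 - x` gains
`1/j`, and a polynomial in `j (1 - x)` costs only a constant. -/
lemma integral_weight_le (D b : ℕ) {c : ℝ} (hc : 0 ≤ c) {j : ℕ} (hj : 1 ≤ j) :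
    ∫ x in (0 : ℝ)..1, x ^ (j - 1) * ((1 - x) ^ b * (1 + c * j * (1 - x)) ^ D) ≤
      2 ^ D * (b.factorial + c ^ D * (b + D).factorial) / (j : ℝ) ^ (b + 1) := by
  obtain ⟨i, rfl⟩ : ∃ i, j = i + 1 := ⟨j - 1, by omega⟩
  rw [Nat.add_sub_cancel]
  push_cast
  set k : ℝ := (i : ℝ) + 1 with hk
  have hk0 : 0 < k := by positivity
  have h1 := integral_pow_mul_one_sub_pow_le i b
  have h2 := integral_pow_mul_one_sub_pow_le i (b + D)
  calc ∫ x in (0 : ℝ)..1, x ^ i * ((1 - x) ^ b * (1 + c * k * (1 - x)) ^ D)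
      ≤ ∫ x in (0 : ℝ)..1, (2 ^ D * (x ^ i * (1 - x) ^ b) +
          2 ^ D * (c * k) ^ D * (x ^ i * (1 - x) ^ (b + D))) := by
        refine intervalIntegral.integral_mono_on zero_le_one
          (Continuous.intervalIntegrable (by fun_prop) _ _)
          (Continuous.intervalIntegrable (by fun_prop) _ _) fun x hx => ?_
        have hy : 0 ≤ 1 - x := by linarith [hx.2]
        have hu : 0 ≤ c * k * (1 - x) := by positivity
        have h3 : (1 + c * k * (1 - x)) ^ D ≤ 2 ^ D * (1 + (c * k * (1 - x)) ^ D) := by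
          have h4 := add_pow_le (zero_le_one (α := ℝ)) hu D
          rw [one_pow] at h4
          refine h4.trans ?_
          gcongr
          · norm_num
          · omega
        have hx' : 0 ≤ x ^ i * (1 - x) ^ b := mul_nonneg (pow_nonneg hx.1 i) (pow_nonneg hy b)
        calc _ = (x ^ i * (1 - x) ^ b) * (1 + c * k * (1 - x)) ^ D := by ring
          _ ≤ (x ^ i * (1 - x) ^ b) * (2 ^ D * (1 + (c * k * (1 - x)) ^ D)) :=
            mul_le_mul_of_nonneg_left h3 hx'
          _ = _ := by rw [mul_pow _ (1 - x), pow_add]; ring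
    _ = 2 ^ D * (∫ x in (0 : ℝ)..1, x ^ i * (1 - x) ^ b) +
          2 ^ D * (c * k) ^ D * ∫ x in (0 : ℝ)..1, x ^ i * (1 - x) ^ (b + D) := by
        rw [intervalIntegral.integral_add (Continuous.intervalIntegrable (by fun_prop) _ _)
          (Continuous.intervalIntegrable (by fun_prop) _ _), intervalIntegral.integral_const_mul,
          intervalIntegral.integral_const_mul]
    _ ≤ 2 ^ D * (b.factorial / k ^ (b + 1)) +
          2 ^ D * (c * k) ^ D * ((b + D).factorial / k ^ (b + D + 1)) := by gcongr
    _ = _ := by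
        rw [mul_pow, show b + D + 1 = (b + 1) + D by ring, pow_add k (b + 1) D]
        field_simp

lemma continuousOn_genReal {D : ℝ} (he : ∀ k, |e (k + 1)| ≤ D) :
    ContinuousOn (genReal e) (Set.Ico 0 1) := by
  have h : ∀ x : ℝ, genReal e x = (genFun e (x : ℂ)).re := fun x => by
    rw [genFun_ofReal, Complex.ofReal_re]
  rw [show genReal e = fun x : ℝ => (genFun e (x : ℂ)).re from funext h]
  refine Complex.continuous_re.comp_continuousOn
    ((differentiableOn_genFun he).continuousOn.comp Complex.continuous_ofReal.continuousOn ?_)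
  intro x hx
  simpa [abs_of_nonneg hx.1] using hx.2

/-- The integral `∫_0^{e^{-1/n}} x ^ (j - 1) / p(x) dx`. -/
noncomputable def recipInt (e : ℕ → ℝ) (n j : ℕ) : ℝ :=
  ∫ x in (0 : ℝ)..rad n, x ^ (j - 1) / genReal e x

lemma continuousOn_recip {D : ℝ} (he : ∀ k, |e (k + 1)| ≤ D) (n j : ℕ) (hn : 1 ≤ n) :
    ContinuousOn (fun x => x ^ (j - 1) / genReal e x) (Set.uIcc 0 (rad n)) := by
  rw [Set.uIcc_of_le (rad_pos n).le]
  refine ContinuousOn.div (by fun_prop) ((continuousOn_genReal he).mono fun x hx => ?_)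
    fun x _ => (genReal_pos e x).ne'
  exact ⟨hx.1, hx.2.trans_lt (rad_lt_one hn)⟩

lemma recipInt_nonneg (e : ℕ → ℝ) (n j : ℕ) : 0 ≤ recipInt e n j :=
  intervalIntegral.integral_nonneg (rad_pos n).le fun x hx =>
    div_nonneg (pow_nonneg hx.1 _) (genReal_pos e x).le

/-- Comparison of `p(x)` with `p(e^{-1/j})`. -/
lemma genReal_rad_mul_le (hD1 : 1 ≤ D) (hθ : 0 ≤ θ) (hθ1 : θ ≤ 1) (hθe : ∀ k, θ ≤ e (k + 1))
    (hD : ∀ k, e (k + 1) ≤ D) {j : ℕ} (hj : 1 ≤ j) (hx0 : 0 ≤ x) (hx : x < 1) :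
    genReal e (rad j) * ((1 + j * (1 - x)) ^ θ / (j * (1 - x)) ^ θ) ≤
      3 * 2 ^ D * (1 + j * (1 - x)) ^ D * genReal e x := by
  have he := abs_le_of_nonneg_of_le (fun k => hθ.trans (hθe k)) hD
  have hj0 : (0 : ℝ) < j := by exact_mod_cast hj
  have hy : 0 < 1 - x := by linarith
  have hr1 := rad_lt_one hj
  have hlow := one_div_le_one_sub_rad hj
  have hrp : 0 < 1 - rad j := by linarith
  have hlow' : 1 ≤ 2 * j * (1 - rad j) := by
    have := mul_le_mul_of_nonneg_left hlow (by positivity : (0 : ℝ) ≤ 2 * j)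
    rwa [mul_one_div_cancel (by positivity)] at this
  set u := j * (1 - x) with hu
  have hu0 : 0 < u := mul_pos hj0 hy
  have hpx := genReal_pos e x
  have hpr := genReal_pos e (rad j)
  rw [← Real.div_rpow (by linarith) hu0.le]
  rcases le_total x (rad j) with h | h
  · have h1 := genReal_le_mul_rpow he hD hx0 h hr1
    rw [Real.rpow_natCast] at h1
    have h2 : (1 - x) / (1 - rad j) ≤ 2 * (1 + u) := by
      rw [div_le_iff₀ hrp]
      have := mul_le_mul_of_nonneg_right hlow' hy.le
      nlinarith
    have h3 : ((1 - x) / (1 - rad j)) ^ D ≤ 2 ^ D * (1 + u) ^ D := by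
      rw [← mul_pow]; exact pow_le_pow_left₀ (by positivity) h2 D
    have hu2 : 1 / 2 ≤ u := by nlinarith
    have h4 : ((1 + u) / u) ^ θ ≤ 3 := by
      have h5 : (1 + u) / u ≤ 3 := by rw [div_le_iff₀ hu0]; linarith
      have h6 : 1 ≤ (1 + u) / u := by rw [le_div_iff₀ hu0]; linarith
      refine (Real.rpow_le_rpow_of_exponent_le h6 hθ1).trans ?_
      rwa [Real.rpow_one]
    calc genReal e (rad j) * ((1 + u) / u) ^ θ
        ≤ (genReal e x * (2 ^ D * (1 + u) ^ D)) * 3 :=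
          mul_le_mul (h1.trans (by gcongr)) h4 (by positivity) (by positivity)
      _ = _ := by ring
  -- For `x` near `1` the growth of `p`, at least that of `(1 - x)^(-θ)`, compensates the singular
  -- factor `(j (1 - x))^(-θ)`.
  · have h1 := mul_rpow_le_genReal he hθe (rad_pos j).le h hx
    have h2 : (1 + u) / u ≤ 2 * (1 + u) * ((1 - rad j) / (1 - x)) := by
      rw [← mul_div_assoc, div_le_div_iff₀ hu0 hy]
      have := mul_le_mul_of_nonneg_right hlow' (by positivity : 0 ≤ (1 + u) * (1 - x))
      rw [hu] at *
      linarith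
    have h3 : (2 * (1 + u)) ^ θ ≤ 2 * (1 + u) ^ D := by
      refine (Real.rpow_le_rpow_of_exponent_le (by linarith) hθ1).trans ?_
      rw [Real.rpow_one]
      have := le_self_pow₀ (by linarith : 1 ≤ 1 + u) (by omega : D ≠ 0)
      linarith
    calc genReal e (rad j) * ((1 + u) / u) ^ θ
        ≤ genReal e (rad j) * (2 * (1 + u) * ((1 - rad j) / (1 - x))) ^ θ := by
          gcongr
      _ = (2 * (1 + u)) ^ θ * (genReal e (rad j) * ((1 - rad j) / (1 - x)) ^ θ) := by
          rw [Real.mul_rpow (by positivity) (by positivity)]; ring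
      _ ≤ (2 * (1 + u) ^ D) * genReal e x := by gcongr
      _ ≤ _ := by
          have h5 : (1 : ℝ) ≤ 2 ^ D := one_le_pow₀ (by norm_num)
          gcongr
          linarith

lemma integral_weight_rad_le (D : ℕ) {n j : ℕ} (hn : 1 ≤ n) (hj : 1 ≤ j) :
    ∫ x in (0 : ℝ)..rad n, x ^ (j - 1) * (1 + j * (1 - x)) ^ D ≤
      2 ^ D * (1 + D.factorial) / j := by
  have hw := integral_weight_le D 0 (zero_le_one (α := ℝ)) hj
  simp only [pow_zero, one_mul, Nat.factorial_zero, Nat.cast_one, one_pow, zero_add, pow_one] at hw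
  refine le_trans ?_ hw
  refine intervalIntegral.integral_mono_interval le_rfl (rad_pos n).le (rad_lt_one hn).le ?_
    (Continuous.intervalIntegrable (by fun_prop) _ _)
  refine (MeasureTheory.ae_restrict_mem measurableSet_Ioc).mono fun x hx => ?_
  have : 0 ≤ 1 - x := by linarith [hx.2]
  have := hx.1.le
  simp only [Pi.zero_apply]
  positivity

lemma recipInt_le (hD1 : 1 ≤ D) (hθ : 0 ≤ θ) (hθ1 : θ ≤ 1) (hθe : ∀ k, θ ≤ e (k + 1))
    (hD : ∀ k, e (k + 1) ≤ D) {n j : ℕ} (hn : 1 ≤ n) (hj : 1 ≤ j) :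
    recipInt e n j ≤ 3 * 2 ^ D * (2 ^ D * (1 + D.factorial)) / (j * genReal e (rad j)) := by
  have he := abs_le_of_nonneg_of_le (fun k => hθ.trans (hθe k)) hD
  have hj0 : (0 : ℝ) < j := by exact_mod_cast hj
  have hpr := genReal_pos e (rad j)
  have hr1 := rad_lt_one hn
  calc recipInt e n j ≤ ∫ x in (0 : ℝ)..rad n,
        3 * 2 ^ D / genReal e (rad j) * (x ^ (j - 1) * (1 + j * (1 - x)) ^ D) := by
        refine intervalIntegral.integral_mono_on (rad_pos n).le
          (continuousOn_recip he n j hn).intervalIntegrable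
          (Continuous.intervalIntegrable (by fun_prop) _ _) fun x hx => ?_
        have hx1 : x < 1 := hx.2.trans_lt hr1
        have hu : 0 < j * (1 - x) := mul_pos hj0 (by linarith)
        have h1 := genReal_rad_mul_le hD1 hθ hθ1 hθe hD hj hx.1 hx1
        rw [← Real.div_rpow (by linarith) hu.le] at h1
        have h2 : 1 ≤ ((1 + j * (1 - x)) / (j * (1 - x))) ^ θ :=
          Real.one_le_rpow (by rw [le_div_iff₀ hu]; linarith) hθ
        have h3 : genReal e (rad j) ≤ 3 * 2 ^ D * (1 + j * (1 - x)) ^ D * genReal e x :=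
          le_trans (le_mul_of_one_le_right hpr.le h2) h1
        rw [div_mul_eq_mul_div, div_le_div_iff₀ (genReal_pos e x) hpr]
        have := mul_le_mul_of_nonneg_left h3 (pow_nonneg hx.1 (j - 1))
        linarith
    _ = 3 * 2 ^ D / genReal e (rad j) *
        ∫ x in (0 : ℝ)..rad n, x ^ (j - 1) * (1 + j * (1 - x)) ^ D :=
        intervalIntegral.integral_const_mul _ _
    _ ≤ 3 * 2 ^ D / genReal e (rad j) * (2 ^ D * (1 + D.factorial) / j) :=
        mul_le_mul_of_nonneg_left (integral_weight_rad_le D hn hj) (by positivity)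
    _ = _ := by field_simp

/-- The substitution `x = e^{-1/n} s` extracts `e^{-j/n}`. The ratio `p(e^{-1/n}) / p(e^{-1/n} s)`
is at most `(1 + n (1 - s))^D`, and `n ≤ j` makes this harmless against `s^(j-1)`. -/
lemma recipInt_le_of_le (h0 : ∀ k, 0 ≤ e (k + 1)) (hD : ∀ k, e (k + 1) ≤ D) {n j : ℕ}
    (hn : 1 ≤ n) (hnj : n ≤ j) :
    recipInt e n j ≤ 2 ^ D * (1 + D.factorial) * (rad n ^ j / (j * genReal e (rad n))) := by
  have hj : 1 ≤ j := hn.trans hnj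
  have he := abs_le_of_nonneg_of_le h0 hD
  have hj0 : (0 : ℝ) < j := by exact_mod_cast hj
  have hnj' : (n : ℝ) ≤ j := by exact_mod_cast hnj
  have hpr := genReal_pos e (rad n)
  have hr0 := rad_pos n
  have hr1 := rad_lt_one hn
  have hw := integral_weight_le D 0 (zero_le_one (α := ℝ)) hj
  simp only [pow_zero, one_mul, Nat.factorial_zero, Nat.cast_one, one_pow, zero_add, pow_one] at hw
  have hsub := intervalIntegral.mul_integral_comp_mul_left (a := 0) (b := 1)
    (f := fun x => x ^ (j - 1) / genReal e x) (rad n)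
  rw [mul_zero, mul_one] at hsub
  have hcont : ContinuousOn (fun s => (rad n * s) ^ (j - 1) / genReal e (rad n * s))
      (Set.uIcc 0 1) := by
    refine (continuousOn_recip he n j hn).comp (f := fun s => rad n * s) (by fun_prop) ?_
    intro s hs
    rw [Set.uIcc_of_le zero_le_one] at hs
    rw [Set.uIcc_of_le hr0.le]
    exact ⟨mul_nonneg hr0.le hs.1, mul_le_of_le_one_right hr0.le hs.2⟩
  have hle : ∫ s in (0 : ℝ)..1, (rad n * s) ^ (j - 1) / genReal e (rad n * s) ≤
      ∫ s in (0 : ℝ)..1,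
        rad n ^ (j - 1) / genReal e (rad n) * (s ^ (j - 1) * (1 + j * (1 - s)) ^ D) := by
    refine intervalIntegral.integral_mono_on zero_le_one hcont.intervalIntegrable
      (Continuous.intervalIntegrable (by fun_prop) _ _) fun s hs => ?_
    have h1 := genReal_defl_rad_le h0 hD hs.1 hs.2 hn
    have h2 := genReal_defl_mul h0 hD hs.1 hs.2 hr0.le hr1
    have hy : 0 ≤ 1 - s := by linarith [hs.2]
    have h3 : genReal e (rad n) ≤ (1 + j * (1 - s)) ^ D * genReal e (rad n * s) := by
      rw [← h2, mul_comm s]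
      gcongr
      · exact (genReal_pos _ _).le
      · exact h1.trans (by gcongr)
    rw [div_mul_eq_mul_div, div_le_div_iff₀ (genReal_pos _ _) hpr, mul_pow]
    have := mul_le_mul_of_nonneg_left h3
      (mul_nonneg (pow_nonneg hr0.le (j - 1)) (pow_nonneg hs.1 (j - 1)))
    linarith
  rw [intervalIntegral.integral_const_mul] at hle
  rw [recipInt, ← hsub]
  calc rad n * ∫ s in (0 : ℝ)..1, (rad n * s) ^ (j - 1) / genReal e (rad n * s)
      ≤ rad n * (rad n ^ (j - 1) / genReal e (rad n) * (2 ^ D * (1 + D.factorial) / j)) := by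
        refine mul_le_mul_of_nonneg_left (hle.trans ?_) hr0.le
        gcongr
    _ = _ := by
        have : rad n ^ j = rad n * rad n ^ (j - 1) := by
          rw [← pow_succ']; congr 1; omega
        rw [this]
        field_simp

end Integrals

/-! ### The weights of `S(g; j)` for `j < n`. -/

section Weights

variable {e : ℕ → ℝ} {D : ℕ} {x θ : ℝ}

/-- The integral `∫_0^1 x ^ (j - 1) [z ^ (n - j)] (p(z) / p(x z)) dx`. -/
noncomputable def meanInt (e : ℕ → ℝ) (n j : ℕ) : ℝ :=
  ∫ x in (0 : ℝ)..1, x ^ (j - 1) * genCoeff (defl x e) (n - j)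

lemma continuousOn_genCoeff_defl (h0 : ∀ k, 0 ≤ e (k + 1)) (hD : ∀ k, e (k + 1) ≤ D) (N : ℕ) :
    ContinuousOn (fun x => genCoeff (defl x e) N) (Set.Icc 0 1) := by
  have hc : Continuous fun x : ℝ =>
      ∑ m ∈ range (N + 1), genCoeff (fun k => -e k) m * x ^ m * genCoeff e (N - m) := by fun_prop
  exact hc.continuousOn.congr fun x hx => genCoeff_defl_eq_sum h0 hD hx.1 hx.2 N

lemma intervalIntegrable_meanInt (h0 : ∀ k, 0 ≤ e (k + 1)) (hD : ∀ k, e (k + 1) ≤ D) (n j : ℕ)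
    {a b : ℝ} (ha : 0 ≤ a) (hab : a ≤ b) (hb : b ≤ 1) :
    IntervalIntegrable (fun x => x ^ (j - 1) * genCoeff (defl x e) (n - j))
      MeasureTheory.volume a b := by
  refine ContinuousOn.intervalIntegrable ?_
  rw [Set.uIcc_of_le hab]
  refine ContinuousOn.mul (by fun_prop) ((continuousOn_genCoeff_defl h0 hD _).mono ?_)
  exact Set.Icc_subset_Icc ha hb

lemma one_div_le_target (hθ1 : θ ≤ 1) (h0 : ∀ k, 0 ≤ e (k + 1))
    (hD : ∀ k, e (k + 1) ≤ D) {n j : ℕ} (hj : 1 ≤ j) (hjn : j ≤ n) :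
    1 / (n * genReal e (rad n)) ≤ ((j : ℝ) / n) ^ θ / (j * genReal e (rad j)) := by
  have hj0 : (0 : ℝ) < j := by exact_mod_cast hj
  have hn0 : (0 : ℝ) < n := by exact_mod_cast hj.trans hjn
  have hjn' : (j : ℝ) ≤ n := by exact_mod_cast hjn
  have hG := genReal_mono h0 hD (rad_pos j).le (rad_mono hj hjn) (rad_lt_one (hj.trans hjn))
  have hGj := genReal_pos e (rad j)
  have h1 : (j : ℝ) / n ≤ ((j : ℝ) / n) ^ θ := by
    have := Real.rpow_le_rpow_of_exponent_ge (x := (j : ℝ) / n) (by positivity)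
      (div_le_one_of_le₀ hjn' hn0.le) hθ1
    rwa [Real.rpow_one] at this
  calc 1 / (n * genReal e (rad n)) ≤ 1 / (n * genReal e (rad j)) := by gcongr
    _ = ((j : ℝ) / n) / (j * genReal e (rad j)) := by field_simp
    _ ≤ _ := by gcongr

/-- Converts the majorant natural for the integrals into the one of the theorem, through `j p_j ≤ 3
D p(e^{-1/j})`. -/
lemma target_le (h0 : ∀ k, 0 < e (k + 1)) (hD : ∀ k, e (k + 1) ≤ D) {n j : ℕ} (hn : 1 ≤ n)
    (hj : 1 ≤ j) : ((j : ℝ) / n) ^ θ / (j * genReal e (rad j)) ≤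
      3 * D * (1 / (n : ℝ) ^ θ * (1 / genCoeff e j * (j : ℝ) ^ (θ - 2))) := by
  have hj0 : (0 : ℝ) < j := by exact_mod_cast hj
  have hn0 : (0 : ℝ) < n := by exact_mod_cast hn
  have hp := genCoeff_pos h0 hD j
  have hG := genReal_pos e (rad j)
  have h1 := mul_genCoeff_le (fun k => (h0 k).le) hD hj le_rfl
  rw [Real.div_rpow hj0.le hn0.le, Real.rpow_sub hj0, Real.rpow_two]
  have hjt := Real.rpow_pos_of_pos hj0 θ
  have hnt := Real.rpow_pos_of_pos hn0 θ
  have h2 : 1 / genReal e (rad j) ≤ 3 * D / (j * genCoeff e j) := by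
    rw [div_le_div_iff₀ hG (by positivity)]; linarith
  calc (j : ℝ) ^ θ / (n : ℝ) ^ θ / (j * genReal e (rad j))
      = (j : ℝ) ^ θ / (n : ℝ) ^ θ / j * (1 / genReal e (rad j)) := by field_simp
    _ ≤ (j : ℝ) ^ θ / (n : ℝ) ^ θ / j * (3 * D / (j * genCoeff e j)) := by gcongr
    _ = _ := by field_simp

/-- Since `j < n`, the coefficient carries a factor `1 - x ≤ 1/n`, and the interval has length at
most `1/n`. -/
lemma integral_rad_one_le (h0 : ∀ k, 0 ≤ e (k + 1)) (hD : ∀ k, e (k + 1) ≤ D) {n j : ℕ}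
    (hjn : j < n) :
    |∫ x in rad n..1, x ^ (j - 1) * genCoeff (defl x e) (n - j)| ≤ 3 * D * 2 ^ D / n ^ 2 := by
  have hn : 1 ≤ n := by omega
  have hn0 : (0 : ℝ) < n := by exact_mod_cast hn
  have hr1 := rad_lt_one hn
  have hr0 := rad_pos n
  have hr := one_sub_rad_le n
  have h := intervalIntegral.norm_integral_le_of_norm_le_const (a := rad n) (b := 1)
    (f := fun x => x ^ (j - 1) * genCoeff (defl x e) (n - j)) (C := 3 * D * (1 / n) * 2 ^ D)
    (fun x hx => by
      rw [Set.uIoc_of_le hr1.le] at hx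
      have hx0 : 0 ≤ x := hr0.le.trans hx.1.le
      have hh0 := genCoeff_nonneg (defl_nonneg h0 hx0 hx.2) (defl_le h0 hD hx0) (n - j)
      have hh := genCoeff_defl_le h0 hD hx0 hx.2 (n := n - j) (by omega)
      have hy : 0 ≤ 1 - x := by linarith [hx.2]
      have hy2 : 1 - x ≤ 1 / n := by linarith [hx.1]
      have hN : ((n - j : ℕ) : ℝ) ≤ n := by exact_mod_cast Nat.sub_le n j
      have h2 : ((n - j : ℕ) : ℝ) * (1 - x) ≤ 1 := by
        calc _ ≤ (n : ℝ) * (1 / n) := by gcongr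
          _ = 1 := mul_one_div_cancel hn0.ne'
      rw [Real.norm_eq_abs, abs_mul, abs_of_nonneg (pow_nonneg hx0 _), abs_of_nonneg hh0]
      calc x ^ (j - 1) * genCoeff (defl x e) (n - j) ≤ 1 * genCoeff (defl x e) (n - j) :=
            mul_le_mul_of_nonneg_right (pow_le_one₀ hx0 hx.2) hh0
        _ ≤ 3 * D * (1 - x) * (1 + (n - j : ℕ) * (1 - x)) ^ D := by rw [one_mul]; exact hh
        _ ≤ 3 * D * (1 / n) * 2 ^ D := by
            gcongr
            linarith)
  rw [Real.norm_eq_abs] at h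
  refine h.trans ?_
  rw [abs_of_nonneg (by linarith)]
  calc 3 * D * (1 / n) * 2 ^ D * (1 - rad n) ≤ 3 * D * (1 / n) * 2 ^ D * (1 / n) := by gcongr
    _ = _ := by field_simp

lemma meanInt_le (h0 : ∀ k, 0 ≤ e (k + 1)) (hD : ∀ k, e (k + 1) ≤ D) {n j : ℕ} (hj : 1 ≤ j)
    (hjn : j < n) (hnj : n ≤ 8 * j) :
    |meanInt e n j| ≤ 3 * D * (2 ^ D * (1 + 8 ^ D * (1 + D).factorial)) * 64 / n ^ 2 := by
  have hn : 1 ≤ n := by omega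
  have hn0 : (0 : ℝ) < n := by exact_mod_cast hn
  have hj0 : (0 : ℝ) < j := by exact_mod_cast hj
  have hnj' : (n : ℝ) ≤ 8 * j := by exact_mod_cast hnj
  have hw := integral_weight_le D 1 (by norm_num : (0 : ℝ) ≤ 8) hj
  simp only [pow_one, Nat.factorial_one, Nat.cast_one] at hw
  have h := intervalIntegral.norm_integral_le_of_norm_le (a := 0) (b := 1)
    (f := fun x => x ^ (j - 1) * genCoeff (defl x e) (n - j)) (μ := MeasureTheory.volume)
    (g := fun x => 3 * D * (x ^ (j - 1) * ((1 - x) * (1 + 8 * j * (1 - x)) ^ D))) zero_le_one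
    (Filter.Eventually.of_forall fun x hx => by
      have hx0 : 0 ≤ x := hx.1.le
      have hh0 := genCoeff_nonneg (defl_nonneg h0 hx0 hx.2) (defl_le h0 hD hx0) (n - j)
      have hh := genCoeff_defl_le h0 hD hx0 hx.2 (n := n - j) (by omega)
      have hy : 0 ≤ 1 - x := by linarith [hx.2]
      have hN : ((n - j : ℕ) : ℝ) ≤ 8 * j := by
        have : n - j ≤ 8 * j := by omega
        exact_mod_cast this
      rw [Real.norm_eq_abs, abs_mul, abs_of_nonneg (pow_nonneg hx0 _), abs_of_nonneg hh0]
      calc x ^ (j - 1) * genCoeff (defl x e) (n - j)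
          ≤ x ^ (j - 1) * (3 * D * (1 - x) * (1 + (n - j : ℕ) * (1 - x)) ^ D) := by gcongr
        _ ≤ x ^ (j - 1) * (3 * D * (1 - x) * (1 + 8 * j * (1 - x)) ^ D) := by gcongr
        _ = _ := by ring)
    (Continuous.intervalIntegrable (by fun_prop) _ _)
  rw [intervalIntegral.integral_const_mul, Real.norm_eq_abs] at h
  refine h.trans ?_
  have hjn2 : 1 / (j : ℝ) ^ (1 + 1) ≤ 64 / (n : ℝ) ^ 2 := by
    rw [div_le_div_iff₀ (by positivity) (by positivity)]
    calc 1 * (n : ℝ) ^ 2 ≤ (8 * j) ^ 2 := by rw [one_mul]; gcongr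
      _ = _ := by ring
  calc _ ≤ 3 * D * (2 ^ D * (1 + 8 ^ D * (1 + D).factorial) / (j : ℝ) ^ (1 + 1)) := by gcongr
    _ = 3 * D * (2 ^ D * (1 + 8 ^ D * (1 + D).factorial)) * (1 / (j : ℝ) ^ (1 + 1)) := by ring
    _ ≤ 3 * D * (2 ^ D * (1 + 8 ^ D * (1 + D).factorial)) * (64 / (n : ℝ) ^ 2) := by gcongr
    _ = _ := by ring

lemma recipInt_le_target (hD1 : 1 ≤ D) (hθ : 0 ≤ θ) (hθ1 : θ ≤ 1) (hθe : ∀ k, θ ≤ e (k + 1))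
    (hD : ∀ k, e (k + 1) ≤ D) {n j : ℕ} (hj : 1 ≤ j) (hjn : j ≤ n) (hnj : n ≤ 8 * j) :
    recipInt e n j ≤ 3 * 2 ^ D * (2 ^ D * (1 + D.factorial)) * 8 *
      (((j : ℝ) / n) ^ θ / (j * genReal e (rad j))) := by
  have hj0 : (0 : ℝ) < j := by exact_mod_cast hj
  have hn0 : (0 : ℝ) < n := by exact_mod_cast hj.trans hjn
  have hjn' : (j : ℝ) ≤ n := by exact_mod_cast hjn
  have hnj' : (n : ℝ) ≤ 8 * j := by exact_mod_cast hnj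
  have hG := genReal_pos e (rad j)
  have h1 : (j : ℝ) / n ≤ ((j : ℝ) / n) ^ θ := by
    have := Real.rpow_le_rpow_of_exponent_ge (x := (j : ℝ) / n) (by positivity)
      (div_le_one_of_le₀ hjn' hn0.le) hθ1
    rwa [Real.rpow_one] at this
  have h2 : 1 / 8 ≤ (j : ℝ) / n := by
    rw [div_le_div_iff₀ (by norm_num) hn0]; linarith
  refine (recipInt_le hD1 hθ hθ1 hθe hD (hj.trans hjn) hj).trans ?_
  rw [← mul_div_assoc]
  refine div_le_div_of_nonneg_right ?_ (by positivity)
  rw [mul_assoc _ (8 : ℝ)]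
  exact le_mul_of_one_le_right (by positivity) (by linarith)

/-- Cancellation is needed only for `8j ≤ n`: there the pointwise comparison is integrated over `[0,
e^{-1/n}]`, and the remaining interval is negligible. For larger `j` each integral is separately
within the bound. -/
lemma exists_abs_meanInt_sub_le (D : ℕ) (hD1 : 1 ≤ D) {b : ℝ} (hb : 0 < b) :
    ∃ C : ℝ, 0 < C ∧ ∀ (e : ℕ → ℝ) (θ : ℝ), 0 ≤ θ → θ ≤ 1 → (∀ k, θ ≤ e (k + 1)) →
    (∀ k, b ≤ e (k + 1)) → (∀ k, e (k + 1) ≤ D) → ∀ n j : ℕ, 1 ≤ j → j < n →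
    |meanInt e n j / genCoeff e n - recipInt e n j| ≤
      C * (((j : ℝ) / n) ^ θ / (j * genReal e (rad j))) := by
  obtain ⟨C₁, hC₁, hmain⟩ := exists_abs_genCoeff_sub_le D
  set C₃ : ℝ := 2 * (4 * (D + 1)) ^ D / b with hC₃
  have hC₃0 : 0 < C₃ := by positivity
  set W : ℝ := 2 ^ D * (1 + D.factorial) with hW
  have hW0 : 0 < W := by positivity
  set V : ℝ := 3 * D * (2 ^ D * (1 + 8 ^ D * (1 + D).factorial)) * 64 with hV
  have hV0 : 0 ≤ V := by positivity
  refine ⟨C₁ * C₃ * (3 * 2 ^ D) * W + 3 * D * 2 ^ D * C₃ + V * C₃ + 3 * 2 ^ D * W * 8,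
    by positivity, ?_⟩
  intro e θ hθ hθ1 hθe hbe hD n j hj hjn
  have h0 : ∀ k, 0 ≤ e (k + 1) := fun k => hθ.trans (hθe k)
  have hn : 1 ≤ n := by omega
  have hn0 : (0 : ℝ) < n := by exact_mod_cast hn
  have hj0 : (0 : ℝ) < j := by exact_mod_cast hj
  have hp : 0 < genCoeff e n := genCoeff_pos (fun k => hb.trans_le (hbe k)) hD n
  have he := abs_le_of_nonneg_of_le h0 hD
  have hR := genReal_pos e (rad n)
  have hG := genReal_pos e (rad j)
  have hRle : genReal e (rad n) ≤ C₃ * (n * genCoeff e n) := genReal_rad_le hb hbe hD hn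
  set τ := ((j : ℝ) / n) ^ θ / (j * genReal e (rad j)) with hτ
  have hτ0 : 0 ≤ τ := by positivity
  have hτ1 := one_div_le_target hθ1 h0 hD hj hjn.le
  -- Errors `O(1/n^2)` become admissible after division by `p_n`, because `n p_n` is at least a
  -- constant times `p(e^{-1/n})`.
  have hsq : ∀ A : ℝ, 0 ≤ A → A / n ^ 2 / genCoeff e n ≤ A * C₃ * τ := by
    intro A hA
    have h1 : 1 / (n * genCoeff e n) ≤ C₃ * (1 / genReal e (rad n)) := by
      rw [mul_one_div, div_le_div_iff₀ (by positivity) hR]; linarith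
    calc A / n ^ 2 / genCoeff e n = A / n * (1 / (n * genCoeff e n)) := by field_simp
      _ ≤ A / n * (C₃ * (1 / genReal e (rad n))) := by gcongr
      _ = A * C₃ * (1 / (n * genReal e (rad n))) := by field_simp
      _ ≤ _ := by gcongr
  by_cases h8 : 8 * j ≤ n
  · have hr0 := (rad_pos n).le
    have hr1 := rad_lt_one hn
    have hi1 := intervalIntegrable_meanInt h0 hD n j le_rfl hr0 hr1.le
    have hi2 := intervalIntegrable_meanInt h0 hD n j hr0 hr1.le le_rfl
    have hsplit : meanInt e n j / genCoeff e n - recipInt e n j =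
        (∫ x in (0 : ℝ)..rad n, (x ^ (j - 1) * genCoeff (defl x e) (n - j) / genCoeff e n -
          x ^ (j - 1) / genReal e x)) +
        (∫ x in rad n..1, x ^ (j - 1) * genCoeff (defl x e) (n - j)) / genCoeff e n := by
      rw [intervalIntegral.integral_sub (hi1.div_const _)
        (continuousOn_recip he n j hn).intervalIntegrable, intervalIntegral.integral_div, meanInt,
        ← intervalIntegral.integral_add_adjacent_intervals hi1 hi2, recipInt]
      ring
    have hB : |(∫ x in rad n..1, x ^ (j - 1) * genCoeff (defl x e) (n - j)) / genCoeff e n| ≤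
        3 * D * 2 ^ D * C₃ * τ := by
      rw [abs_div, abs_of_pos hp]
      refine le_trans ?_ (hsq _ (by positivity))
      gcongr
      exact integral_rad_one_le h0 hD hjn
    have hA : |∫ x in (0 : ℝ)..rad n, (x ^ (j - 1) * genCoeff (defl x e) (n - j) / genCoeff e n -
          x ^ (j - 1) / genReal e x)| ≤ C₁ * C₃ * (3 * 2 ^ D) * W * τ := by
      have h := intervalIntegral.norm_integral_le_of_norm_le (a := 0) (b := rad n)
        (f := fun x => x ^ (j - 1) * genCoeff (defl x e) (n - j) / genCoeff e n -
          x ^ (j - 1) / genReal e x) (μ := MeasureTheory.volume)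
        (g := fun x => C₁ * C₃ * (3 * 2 ^ D) * (((j : ℝ) / n) ^ θ / genReal e (rad j)) *
          (x ^ (j - 1) * (1 + j * (1 - x)) ^ D)) hr0
        (Filter.Eventually.of_forall fun x hx => by
          have hx0 : 0 ≤ x := hx.1.le
          have hx1 : x < 1 := hx.2.trans_lt hr1
          have hy : 0 < 1 - x := by linarith
          have hP := genReal_pos e x
          have hm := hmain e θ hθ hθ1 hθe hD n j hn h8 x hx0 hx.2
          have hg := genReal_rad_mul_le hD1 hθ hθ1 hθe hD hj hx0 hx1
          have hU : (1 + j * (1 - x)) ^ θ / (n * (1 - x)) ^ θ = ((j : ℝ) / n) ^ θ *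
              ((1 + j * (1 - x)) ^ θ / (j * (1 - x)) ^ θ) := by
            rw [Real.mul_rpow hn0.le hy.le, Real.mul_rpow hj0.le hy.le,
              Real.div_rpow hj0.le hn0.le]
            have := Real.rpow_pos_of_pos hy θ
            have := Real.rpow_pos_of_pos hn0 θ
            have := Real.rpow_pos_of_pos hj0 θ
            field_simp
          rw [hU] at hm
          set Q := (1 + j * (1 - x)) ^ θ / (j * (1 - x)) ^ θ with hQ
          have hQ0 : 0 ≤ Q := by positivity
          have hid : x ^ (j - 1) * genCoeff (defl x e) (n - j) / genCoeff e n -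
              x ^ (j - 1) / genReal e x = -(x ^ (j - 1) / (genCoeff e n * genReal e x) *
              (genCoeff e n - genReal e x * genCoeff (defl x e) (n - j))) := by
            field_simp
            ring
          have hxj : 0 ≤ x ^ (j - 1) := pow_nonneg hx0 _
          rw [hid, norm_neg, Real.norm_eq_abs, abs_mul, abs_of_nonneg (by positivity)]
          have hR' : genReal e (rad n) / n ≤ C₃ * genCoeff e n := by
            rw [div_le_iff₀ hn0]; linarith
          have hg' : Q / genReal e x ≤ 3 * 2 ^ D * (1 + j * (1 - x)) ^ D / genReal e (rad j) := by
            rw [div_le_div_iff₀ hP hG]; linarith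
          calc _ ≤ x ^ (j - 1) / (genCoeff e n * genReal e x) *
                (C₁ * (C₃ * genCoeff e n) * (((j : ℝ) / n) ^ θ * Q)) := by
                refine mul_le_mul_of_nonneg_left (hm.trans ?_) (by positivity)
                gcongr
            _ = C₁ * C₃ * ((j : ℝ) / n) ^ θ * x ^ (j - 1) * (Q / genReal e x) := by field_simp
            _ ≤ C₁ * C₃ * ((j : ℝ) / n) ^ θ * x ^ (j - 1) *
                (3 * 2 ^ D * (1 + j * (1 - x)) ^ D / genReal e (rad j)) := by gcongr
            _ = _ := by ring)
        (Continuous.intervalIntegrable (by fun_prop) _ _)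
      rw [intervalIntegral.integral_const_mul, Real.norm_eq_abs] at h
      refine h.trans ?_
      calc _ ≤ C₁ * C₃ * (3 * 2 ^ D) * (((j : ℝ) / n) ^ θ / genReal e (rad j)) * (W / j) :=
            mul_le_mul_of_nonneg_left (integral_weight_rad_le D hn hj) (by positivity)
        _ = _ := by rw [hτ]; field_simp
    rw [hsplit]
    refine (abs_add_le _ _).trans ((add_le_add hA hB).trans ?_)
    have : 0 ≤ (V * C₃ + 3 * 2 ^ D * W * 8) * τ := by positivity
    linarith
  · have h8' : n ≤ 8 * j := by omega
    have hA : |meanInt e n j / genCoeff e n| ≤ V * C₃ * τ := by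
      rw [abs_div, abs_of_pos hp]
      refine le_trans ?_ (hsq V hV0)
      gcongr
      exact meanInt_le h0 hD hj hjn h8'
    have hB := recipInt_le_target hD1 hθ hθ1 hθe hD hj hjn.le h8'
    refine (abs_sub _ _).trans ?_
    rw [abs_of_nonneg (recipInt_nonneg e n j)]
    refine (add_le_add hA hB).trans ?_
    have : 0 ≤ (C₁ * C₃ * (3 * 2 ^ D) * W + 3 * D * 2 ^ D * C₃) * τ := by positivity
    linarith

end Weights

/-! ### Expressing the mean and `g(e^{-1/n})` through `S(g; j)`. -/

section Inversion

variable {e : ℕ → ℝ} {D : ℕ} {θ : ℝ}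

lemma S_zero (p : ℕ → ℝ) (a : ℕ → ℂ) : S p a 0 = 0 := by simp [S]

lemma genCoeff_zero_seq (n : ℕ) : genCoeff (fun _ => 0) n = if n = 0 then 1 else 0 := by
  rcases n with _ | n
  · simp [genCoeff_zero]
  · have h := genCoeff_succ (e := fun _ => 0) (D := 0) (fun k => by simp) n
    simp only [zero_mul, sum_const_zero] at h
    simpa using (mul_eq_zero.1 h).resolve_left (by positivity)

/-- The coefficients of `1 / p(z)` invert the convolution defining `S`. -/
lemma sum_S_mul_genCoeff_neg {D : ℝ} (he : ∀ k, |e (k + 1)| ≤ D) (a : ℕ → ℂ) (k : ℕ) :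
    ∑ j ∈ range (k + 1), S (genCoeff e) a j * (genCoeff (fun i => -e i) (k - j) : ℂ) =
      k * a k := by
  have hneg : ∀ k, |-e (k + 1)| ≤ D := fun k => by rw [abs_neg]; exact he k
  set A : PowerSeries ℂ := PowerSeries.mk fun k => a k * k
  set P : PowerSeries ℂ := PowerSeries.mk fun k => (genCoeff e k : ℂ)
  set Q : PowerSeries ℂ := PowerSeries.mk fun k => (genCoeff (fun i => -e i) k : ℂ)
  have hPQ : P * Q = 1 := by
    ext n
    rw [PowerSeries.coeff_mul, Nat.sum_antidiagonal_eq_sum_range_succ_mk, PowerSeries.coeff_one]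
    have h := genCoeff_add (f := fun i => -e i) he hneg n
    rw [show (fun k => e k + -e k) = fun _ => 0 by funext k; ring, genCoeff_zero_seq] at h
    simp only [P, Q, PowerSeries.coeff_mk]
    rw [show (if n = 0 then (1 : ℂ) else 0) = ((if n = 0 then (1 : ℝ) else 0 : ℝ) : ℂ) by
      split_ifs <;> simp, h]
    push_cast
    rfl
  have hS : (PowerSeries.mk fun j => S (genCoeff e) a j) = A * P := by
    ext n
    rw [PowerSeries.coeff_mul, Nat.sum_antidiagonal_eq_sum_range_succ_mk]
    simp [A, P, S]
  have h : (PowerSeries.mk fun j => S (genCoeff e) a j) * Q = A := by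
    rw [hS, mul_assoc, hPQ, mul_one]
  have h2 := congrArg (PowerSeries.coeff k) h
  rw [PowerSeries.coeff_mul, Nat.sum_antidiagonal_eq_sum_range_succ_mk] at h2
  simp only [A, Q, PowerSeries.coeff_mk] at h2
  rw [mul_comm (k : ℂ)]
  exact h2

lemma coeff_eq_sum_S {D : ℝ} (he : ∀ k, |e (k + 1)| ≤ D) (a : ℕ → ℂ) (k : ℕ) :
    a k = (if k = 0 then a 0 else 0) + (∑ j ∈ range (k + 1),
      S (genCoeff e) a j * (genCoeff (fun i => -e i) (k - j) : ℂ)) / k := by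
  -- At `k = 0` the quotient is `0 / 0 = 0`, so `a 0` comes from the other summand.
  rw [sum_S_mul_genCoeff_neg he]
  rcases k with _ | k
  · simp
  · rw [if_neg (by omega), zero_add, mul_div_cancel_left₀]
    exact_mod_cast Nat.succ_ne_zero k

lemma meanInt_eq_sum (h0 : ∀ k, 0 ≤ e (k + 1)) (hD : ∀ k, e (k + 1) ≤ D) {n j : ℕ}
    (hj : 1 ≤ j) : meanInt e n j = ∑ m ∈ range (n - j + 1),
      genCoeff (fun k => -e k) m * genCoeff e (n - j - m) / ((j + m : ℕ) : ℝ) := by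
  have h1 : meanInt e n j = ∫ x in (0 : ℝ)..1, ∑ m ∈ range (n - j + 1),
      genCoeff (fun k => -e k) m * genCoeff e (n - j - m) * x ^ (j - 1 + m) := by
    refine intervalIntegral.integral_congr fun x hx => ?_
    rw [Set.uIcc_of_le zero_le_one] at hx
    rw [genCoeff_defl_eq_sum h0 hD hx.1 hx.2, mul_sum]
    exact sum_congr rfl fun m _ => by rw [pow_add]; ring
  rw [h1, intervalIntegral.integral_finsetSum fun m _ =>
    Continuous.intervalIntegrable (by fun_prop) _ _]
  refine sum_congr rfl fun m _ => ?_
  rw [intervalIntegral.integral_const_mul, integral_pow,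
    show ((j + m : ℕ) : ℝ) = ((j - 1 + m : ℕ) : ℝ) + 1 by
      rw [← Nat.cast_succ]; congr 1; omega]
  simp [div_eq_mul_inv]

lemma meanInt_self (e : ℕ → ℝ) {n : ℕ} (hn : 1 ≤ n) : meanInt e n n = 1 / n := by
  obtain ⟨m, rfl⟩ : ∃ m, n = m + 1 := ⟨n - 1, by omega⟩
  simp [meanInt, genCoeff_zero, integral_pow]

lemma sum_mul_genCoeff_eq (h0 : ∀ k, 0 ≤ e (k + 1)) (hD : ∀ k, e (k + 1) ≤ D) (a : ℕ → ℂ)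
    (n : ℕ) : ∑ k ∈ range (n + 1), a k * (genCoeff e (n - k) : ℂ) =
      a 0 * genCoeff e n + ∑ j ∈ Icc 1 n, S (genCoeff e) a j * (meanInt e n j : ℂ) := by
  have he := abs_le_of_nonneg_of_le h0 hD
  set q : ℕ → ℝ := genCoeff fun k => -e k with hq
  have h1 : ∀ k ∈ range (n + 1), a k * (genCoeff e (n - k) : ℂ) =
      (if k = 0 then a 0 * genCoeff e n else 0) + ∑ j ∈ range (k + 1),
        S (genCoeff e) a j * (q (k - j) : ℂ) / k * (genCoeff e (n - k) : ℂ) := by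
    intro k _
    conv_lhs => rw [coeff_eq_sum_S he a k]
    rw [add_mul, sum_div, sum_mul]
    congr 1
    by_cases hk : k = 0
    · simp [hk]
    · simp [hk]
  rw [sum_congr rfl h1, sum_add_distrib, sum_ite_eq' (range (n + 1)) 0]
  simp only [mem_range, Nat.succ_pos, if_true]
  congr 1
  rw [sum_comm' (t' := range (n + 1)) (s' := fun j => Ico j (n + 1)) (by
    intro x y; simp only [mem_range, mem_Ico]; omega)]
  rw [range_eq_Ico, sum_eq_sum_Ico_succ_bot (Nat.succ_pos n)]
  simp only [S_zero, zero_mul, zero_div, sum_const_zero, zero_add]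
  refine sum_congr (by ext x; simp only [mem_Ico, mem_Icc]; omega) fun j hj => ?_
  obtain ⟨hj1, hjn⟩ := mem_Icc.1 hj
  rw [meanInt_eq_sum h0 hD hj1, sum_Ico_eq_sum_range, Complex.ofReal_sum, mul_sum,
    show n + 1 - j = n - j + 1 by omega]
  refine sum_congr rfl fun m _ => ?_
  rw [Nat.add_sub_cancel_left, Nat.sub_sub]
  push_cast
  ring

lemma hasSum_recipInt {D : ℝ} (he : ∀ k, |e (k + 1)| ≤ D) {n j : ℕ} (hn : 1 ≤ n) (hj : 1 ≤ j) :
    HasSum (fun m : ℕ => genCoeff (fun k => -e k) m * rad n ^ (j + m) / ((j + m : ℕ) : ℝ))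
      (recipInt e n j) := by
  have hneg : ∀ k, |-e (k + 1)| ≤ D := fun k => by rw [abs_neg]; exact he k
  have hr0 := (rad_pos n).le
  have hr1 := rad_lt_one hn
  have hsum := (hasSum_genReal (e := fun k => -e k) hneg hr0 hr1).summable.abs
  have h := intervalIntegral.hasSum_integral_of_dominated_convergence
    (μ := MeasureTheory.volume) (a := 0) (b := rad n)
    (F := fun (m : ℕ) (x : ℝ) => genCoeff (fun k => -e k) m * x ^ (j - 1 + m))
    (f := fun x => x ^ (j - 1) / genReal e x)
    (fun m _ => |genCoeff (fun k => -e k) m * rad n ^ m|)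
    (fun m => (by fun_prop : Continuous fun x : ℝ =>
      genCoeff (fun k => -e k) m * x ^ (j - 1 + m)).aestronglyMeasurable)
    (fun m => Filter.Eventually.of_forall fun x hx => by
      rw [Set.uIoc_of_le hr0] at hx
      rw [Real.norm_eq_abs, abs_mul, abs_mul, abs_of_nonneg (pow_nonneg hx.1.le _),
        abs_of_nonneg (pow_nonneg hr0 _), pow_add]
      refine mul_le_mul_of_nonneg_left ?_ (abs_nonneg _)
      calc x ^ (j - 1) * x ^ m ≤ 1 * rad n ^ m :=
            mul_le_mul (pow_le_one₀ hx.1.le (hx.2.trans hr1.le))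
              (pow_le_pow_left₀ hx.1.le hx.2 m) (pow_nonneg hx.1.le m) zero_le_one
        _ = _ := one_mul _)
    (Filter.Eventually.of_forall fun x _ => hsum)
    (by simp)
    (Filter.Eventually.of_forall fun x hx => by
      rw [Set.uIoc_of_le hr0] at hx
      have hx1 : x < 1 := hx.2.trans_lt hr1
      have h1 := (hasSum_genReal (e := fun k => -e k) hneg hx.1.le hx1).mul_left (x ^ (j - 1))
      have h2 := genReal_add (f := fun k => -e k) he hneg hx.1.le hx1
      have h3 : genReal (fun k => e k + -e k) x = 1 := by simp [genReal]
      rw [h3] at h2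
      rw [eq_div_of_mul_eq (genReal_pos e x).ne' (by rw [mul_comm]; exact h2.symm :
        genReal (fun k => -e k) x * genReal e x = 1), mul_one_div] at h1
      refine h1.congr_fun ?_
      intro m
      rw [pow_add]; ring)
  refine h.congr_fun fun m => ?_
  rw [intervalIntegral.integral_const_mul, integral_pow,
    show ((j + m : ℕ) : ℝ) = ((j - 1 + m : ℕ) : ℝ) + 1 by
      rw [← Nat.cast_succ]; congr 1; omega, show j - 1 + m + 1 = j + m by omega,
    zero_pow (by omega), sub_zero, mul_div_assoc]

lemma summable_norm_mul_coeff {a : ℕ → ℂ} {g : ℂ → ℂ}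
    (hg : ∀ z : ℂ, ‖z‖ < 1 → HasSum (fun k : ℕ => a k * z ^ k) (g z)) {r : ℝ} (hr0 : 0 ≤ r)
    (hr : r < 1) : Summable fun k : ℕ => ‖a k * k * (r : ℂ) ^ k‖ := by
  obtain ⟨s, hrs, hs1⟩ := exists_between hr
  have hs0 : 0 < s := hr0.trans_lt hrs
  have hs := (hg (s : ℂ) (by simpa [abs_of_pos hs0] using hs1)).summable
  obtain ⟨B, hB⟩ := hs.tendsto_atTop_zero.norm.bddAbove_range
  have hgeo := summable_pow_mul_geometric_of_norm_lt_one 1 (r := r / s)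
    (by rw [Real.norm_of_nonneg (by positivity)]; exact (div_lt_one hs0).2 hrs)
  refine Summable.of_nonneg_of_le (fun k => norm_nonneg _) (fun k => ?_) (hgeo.mul_left B)
  have h1 : ‖a k * (s : ℂ) ^ k‖ ≤ B := hB ⟨k, rfl⟩
  have h2 : ‖a k * k * (r : ℂ) ^ k‖ = ‖a k * (s : ℂ) ^ k‖ * ((k : ℝ) ^ 1 * (r / s) ^ k) := by
    simp only [norm_mul, norm_pow, Complex.norm_natCast, Complex.norm_real, Real.norm_eq_abs,
      abs_of_nonneg hr0, abs_of_pos hs0, div_pow]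
    field_simp
  rw [h2]
  gcongr

lemma summable_norm_S {D : ℝ} (he : ∀ k, |e (k + 1)| ≤ D) {a : ℕ → ℂ} {g : ℂ → ℂ}
    (hg : ∀ z : ℂ, ‖z‖ < 1 → HasSum (fun k : ℕ => a k * z ^ k) (g z)) {r : ℝ} (hr0 : 0 ≤ r)
    (hr : r < 1) : Summable fun j : ℕ => ‖S (genCoeff e) a j‖ * r ^ j := by
  have h1 := summable_norm_mul_coeff hg hr0 hr
  have h2 : Summable fun k : ℕ => ‖(genCoeff e k : ℂ) * (r : ℂ) ^ k‖ :=
    ((hasSum_genCoeff he (z := (r : ℂ))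
      (by simpa [abs_of_nonneg hr0] using hr)).summable).norm
  have h3 := summable_norm_sum_mul_range_of_summable_norm h1 h2
  refine h3.congr fun j => ?_
  have : ∑ k ∈ range (j + 1), a k * k * (r : ℂ) ^ k * ((genCoeff e (j - k) : ℂ) *
      (r : ℂ) ^ (j - k)) = S (genCoeff e) a j * (r : ℂ) ^ j := by
    rw [S, sum_mul]
    refine sum_congr rfl fun k hk => ?_
    have hkj : k ≤ j := by simpa [Nat.lt_succ_iff] using hk
    rw [show (r : ℂ) ^ j = (r : ℂ) ^ k * (r : ℂ) ^ (j - k) by rw [← pow_add]; congr 1; omega]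
    ring
  rw [this, norm_mul, norm_pow, Complex.norm_real, Real.norm_of_nonneg hr0]

/-- Let `q` be the coefficients of `1/p` and `r = e^{-1/n}`. The double series of `S(g; j) q_m
r^(j+m) / (j+m)` converges absolutely: its rows sum to the integrals, its antidiagonals to `a_k r^k`
for `k ≥ 1`. -/
lemma hasSum_S_mul_recipInt {D : ℝ} (he : ∀ k, |e (k + 1)| ≤ D) {a : ℕ → ℂ} {g : ℂ → ℂ}
    (hg : ∀ z : ℂ, ‖z‖ < 1 → HasSum (fun k : ℕ => a k * z ^ k) (g z)) {n : ℕ} (hn : 1 ≤ n) :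
    HasSum (fun j : ℕ => S (genCoeff e) a j * (recipInt e n j : ℂ)) (g (rad n : ℂ) - a 0) := by
  have hneg : ∀ k, |-e (k + 1)| ≤ D := fun k => by rw [abs_neg]; exact he k
  have hr0 := (rad_pos n).le
  have hr1 := rad_lt_one hn
  have hrz : ‖(rad n : ℂ)‖ < 1 := by simpa [abs_of_nonneg hr0] using hr1
  set q : ℕ → ℝ := genCoeff fun k => -e k with hq
  set F : ℕ × ℕ → ℂ := fun x => S (genCoeff e) a x.1 * ((q x.2 * rad n ^ (x.1 + x.2) /
    ((x.1 + x.2 : ℕ) : ℝ) : ℝ) : ℂ) with hF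
  have hsq : Summable fun m : ℕ => |q m * rad n ^ m| :=
    (hasSum_genReal (e := fun k => -e k) hneg hr0 hr1).summable.abs
  have hFsum : Summable F := by
    refine Summable.of_norm_bounded
      ((summable_norm_S he hg hr0 hr1).mul_of_nonneg hsq (fun j => by positivity)
        fun m => abs_nonneg _) fun x => ?_
    simp only [hF]
    rw [norm_mul, Complex.norm_real, Real.norm_eq_abs, mul_assoc]
    refine mul_le_mul_of_nonneg_left ?_ (norm_nonneg _)
    rw [abs_div, pow_add, mul_left_comm, abs_mul, abs_of_nonneg (pow_nonneg hr0 x.1), Nat.abs_cast]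
    -- The pair `(0, 0)` has denominator `0`, and its term is `0`.
    rcases Nat.eq_zero_or_pos (x.1 + x.2) with h | h
    · rw [h, Nat.cast_zero, div_zero]; positivity
    · exact div_le_self (by positivity) (by exact_mod_cast h)
  have hrow : HasSum (fun j : ℕ => S (genCoeff e) a j * (recipInt e n j : ℂ)) (∑' x, F x) := by
    refine hFsum.hasSum.prod_fiberwise fun j => ?_
    rcases Nat.eq_zero_or_pos j with rfl | hj
    · simp only [hF, S_zero, zero_mul]; exact hasSum_zero
    · have h := (Complex.hasSum_ofReal (f := fun m : ℕ => q m * rad n ^ (j + m) /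
        ((j + m : ℕ) : ℝ))).2 (hasSum_recipInt he hn hj)
      exact h.mul_left (S (genCoeff e) a j)
  have hdiag : HasSum (fun k : ℕ => ∑ x ∈ antidiagonal k, F x) (∑' x, F x) := by
    have h1 := (HasAntidiagonal.sigmaAntidiagonalEquivProd (A := ℕ)).hasSum_iff.2 hFsum.hasSum
    exact h1.sigma fun k => (antidiagonal k).hasSum F
  have hk : ∀ k : ℕ, ∑ x ∈ antidiagonal k, F x =
      a k * (rad n : ℂ) ^ k - if k = 0 then a 0 else 0 := by
    intro k
    rw [Nat.sum_antidiagonal_eq_sum_range_succ_mk]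
    have hcoeff := coeff_eq_sum_S he a k
    have : a k * (rad n : ℂ) ^ k - (if k = 0 then a 0 else 0) =
        (∑ j ∈ range (k + 1), S (genCoeff e) a j * (q (k - j) : ℂ)) / k * (rad n : ℂ) ^ k := by
      rcases k with _ | k
      · simp
      · conv_lhs => rw [hcoeff]
        rw [if_neg (by omega), zero_add, sub_zero]
    rw [this, sum_div, sum_mul]
    refine sum_congr rfl fun j hj => ?_
    have hjk : j ≤ k := by simpa [Nat.lt_succ_iff] using hj
    simp only [hF]
    rw [Nat.add_sub_cancel' hjk]
    push_cast
    ring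
  have hg' := (hg (rad n : ℂ) hrz).sub (hasSum_ite_eq 0 (a 0))
  rw [show (∑' x, F x) = g (rad n : ℂ) - a 0 from hdiag.unique (by
    simpa only [hk] using hg')] at hrow
  exact hrow

end Inversion

/-! ### Assembly of the error estimate. -/

/-- The error as a combination of the `S(g; j)`. -/
lemma mean_sub_eq {e : ℕ → ℝ} {D : ℕ} (h0 : ∀ k, 0 < e (k + 1)) (hD : ∀ k, e (k + 1) ≤ D)
    {a : ℕ → ℂ} {g : ℂ → ℂ}
    (hg : ∀ z : ℂ, ‖z‖ < 1 → HasSum (fun k : ℕ => a k * z ^ k) (g z)) {n : ℕ} (hn : 1 ≤ n) :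
    mean (genCoeff e) a n - g (rad n : ℂ) -
        S (genCoeff e) a n / ((n : ℂ) * (genCoeff e n : ℂ)) =
      ∑ j ∈ Icc 1 n, S (genCoeff e) a j * ((meanInt e n j / genCoeff e n - recipInt e n j -
        (if j = n then 1 / (n * genCoeff e n) else 0) : ℝ) : ℂ) -
      ∑' j : Set.Ioi n, S (genCoeff e) a j * (recipInt e n j : ℂ) := by
  have h0' : ∀ k, 0 ≤ e (k + 1) := fun k => (h0 k).le
  have he := abs_le_of_nonneg_of_le h0' hD
  have hp : (genCoeff e n : ℂ) ≠ 0 := by exact_mod_cast (genCoeff_pos h0 hD n).ne'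
  have hs := hasSum_S_mul_recipInt he hg hn
  have hsplit := hs.summable.sum_add_tsum_compl (s := range (n + 1))
  rw [hs.tsum_eq, show ((range (n + 1) : Finset ℕ) : Set ℕ)ᶜ = Set.Ioi n by
    ext x; simp, range_eq_Ico, sum_eq_sum_Ico_succ_bot (Nat.succ_pos n), S_zero,
    zero_mul, zero_add, show Ico (0 + 1) (n + 1) = Icc 1 n by
      ext x; simp only [mem_Ico, mem_Icc]; omega] at hsplit
  have hlast : ∑ j ∈ Icc 1 n, S (genCoeff e) a j *
      (((if j = n then 1 / (n * genCoeff e n) else 0) : ℝ) : ℂ) =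
      S (genCoeff e) a n / ((n : ℂ) * (genCoeff e n : ℂ)) := by
    rw [sum_eq_single n (fun j _ hj => by simp [hj]) (fun h => absurd (mem_Icc.2 ⟨hn, le_rfl⟩) h)]
    rw [if_pos rfl]
    push_cast
    rw [mul_one_div]
  have hmean : mean (genCoeff e) a n = a 0 +
      ∑ j ∈ Icc 1 n, S (genCoeff e) a j * ((meanInt e n j / genCoeff e n : ℝ) : ℂ) := by
    rw [mean, sum_mul_genCoeff_eq h0' hD, mul_add, mul_sum]
    congr 1
    · field_simp
    · refine sum_congr rfl fun j _ => ?_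
      push_cast
      ring
  have hexp : ∀ j : ℕ, S (genCoeff e) a j * ((meanInt e n j / genCoeff e n - recipInt e n j -
      (if j = n then 1 / (n * genCoeff e n) else 0) : ℝ) : ℂ) =
      S (genCoeff e) a j * ((meanInt e n j / genCoeff e n : ℝ) : ℂ) -
      S (genCoeff e) a j * (recipInt e n j : ℂ) - S (genCoeff e) a j *
      (((if j = n then 1 / (n * genCoeff e n) else 0) : ℝ) : ℂ) := by
    intro j
    rw [Complex.ofReal_sub, Complex.ofReal_sub]
    ring
  simp only [hexp, sum_sub_distrib]
  rw [hlast, hmean]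
  linear_combination hsplit

/-- The weights of `S(g; j)`, `j ≤ n`, in the error. -/
lemma exists_abs_weight_le (D : ℕ) (hD1 : 1 ≤ D) {b : ℝ} (hb : 0 < b) :
    ∃ C : ℝ, 0 < C ∧ ∀ (e : ℕ → ℝ) (θ : ℝ), 0 ≤ θ → θ ≤ 1 → (∀ k, θ ≤ e (k + 1)) →
    (∀ k, b ≤ e (k + 1)) → (∀ k, e (k + 1) ≤ D) → ∀ n j : ℕ, 1 ≤ j → j ≤ n →
    |meanInt e n j / genCoeff e n - recipInt e n j -
        (if j = n then 1 / (n * genCoeff e n) else 0)| ≤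
      C * (1 / (n : ℝ) ^ θ * (1 / genCoeff e j * (j : ℝ) ^ (θ - 2))) := by
  obtain ⟨C, hC, hmain⟩ := exists_abs_meanInt_sub_le D hD1 hb
  set C' : ℝ := 3 * 2 ^ D * (2 ^ D * (1 + D.factorial)) * 8 with hC'
  have hC'0 : 0 < C' := by positivity
  have hD0 : (0 : ℝ) < D := by exact_mod_cast hD1
  refine ⟨(C + C') * (3 * D), by positivity, ?_⟩
  intro e θ hθ hθ1 hθe hbe hD n j hj hjn
  have h0 : ∀ k, 0 < e (k + 1) := fun k => hb.trans_le (hbe k)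
  have ht := target_le (θ := θ) h0 hD (hj.trans hjn) hj
  have hG := genReal_pos e (rad j)
  set τ := ((j : ℝ) / n) ^ θ / (j * genReal e (rad j)) with hτ
  have hτ0 : 0 ≤ τ := by positivity
  suffices h : |meanInt e n j / genCoeff e n - recipInt e n j -
      (if j = n then 1 / (n * genCoeff e n) else 0)| ≤ (C + C') * τ by
    refine h.trans ?_
    rw [mul_assoc]
    exact mul_le_mul_of_nonneg_left ht (by positivity)
  rcases hjn.lt_or_eq with hlt | rfl
  · rw [if_neg hlt.ne, sub_zero]
    refine (hmain e θ hθ hθ1 hθe hbe hD n j hj hlt).trans ?_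
    have : 0 ≤ C' * τ := by positivity
    linarith
  -- For `j = n` the integral `1/n` cancels the correction exactly, leaving only the integral of
  -- `x^(n-1) / p(x)`.
  · rw [if_pos rfl, meanInt_self e hj, div_div, sub_sub_cancel_left, abs_neg,
      abs_of_nonneg (recipInt_nonneg e j j)]
    refine (recipInt_le_target hD1 hθ hθ1 hθe hD hj le_rfl (by omega)).trans ?_
    have : 0 ≤ C * τ := by positivity
    linarith

end Voronoi

open Voronoi

theorem theorem1 (dm dp : ℝ) (hdm : 0 < dm) :
    ∃ c : ℝ, 0 < c ∧
      ∀ d : ℕ → ℝ, (∀ k : ℕ, 1 ≤ k → dm ≤ d k ∧ d k ≤ dp) →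
        (∀ j : ℕ, 0 < Voronoi.genCoeff d j) ∧
        (∀ z : ℂ, ‖z‖ < 1 →
          HasSum (fun j : ℕ => (Voronoi.genCoeff d j : ℂ) * z ^ j) (Voronoi.genFun d z)) ∧
        ∀ (a : ℕ → ℂ) (g : ℂ → ℂ),
          (∀ z : ℂ, ‖z‖ < 1 → HasSum (fun k : ℕ => a k * z ^ k) (g z)) →
          ∀ n : ℕ, 1 ≤ n →
            Summable (fun j : Set.Ioi n =>
              ‖Voronoi.S (Voronoi.genCoeff d) a (j : ℕ)‖ / ((j : ℕ) : ℝ) *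
                Real.exp (-((j : ℕ) : ℝ) / (n : ℝ))) ∧
            ‖Voronoi.mean (Voronoi.genCoeff d) a n - g (Real.exp (-1 / (n : ℝ)) : ℂ) -
                Voronoi.S (Voronoi.genCoeff d) a n /
                  ((n : ℂ) * (Voronoi.genCoeff d n : ℂ))‖ ≤
              c * (1 / (n : ℝ) ^ (min dm 1) *
                    ∑ j ∈ Finset.Icc 1 n,
                      ‖Voronoi.S (Voronoi.genCoeff d) a j‖ / Voronoi.genCoeff d j *
                        (j : ℝ) ^ (min dm 1 - 2) +
                  1 / (Voronoi.genFun d (Real.exp (-1 / (n : ℝ)) : ℂ)).re *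
                    ∑' j : Set.Ioi n,
                      ‖Voronoi.S (Voronoi.genCoeff d) a (j : ℕ)‖ / ((j : ℕ) : ℝ) *
                        Real.exp (-((j : ℕ) : ℝ) / (n : ℝ))) := by
  -- An integer upper bound keeps all growth factors ordinary powers; `D ≥ 1` is needed for `1 + u ≤
  -- (1 + u)^D`.
  set D : ℕ := max 1 ⌈dp⌉₊ with hD_def
  have hD1 : 1 ≤ D := le_max_left _ _
  have hdpD : dp ≤ D := (Nat.le_ceil dp).trans (by exact_mod_cast le_max_right _ _)
  set θ : ℝ := min dm 1 with hθ_def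
  have hθ0 : 0 ≤ θ := le_min hdm.le zero_le_one
  have hθ1 : θ ≤ 1 := min_le_right _ _
  obtain ⟨C, hC, hweight⟩ := exists_abs_weight_le D hD1 hdm
  set C' : ℝ := 2 ^ D * (1 + D.factorial) with hC'
  have hC'0 : 0 < C' := by positivity
  refine ⟨C + C', by positivity, fun d hd => ?_⟩
  have hbe : ∀ k, dm ≤ d (k + 1) := fun k => (hd (k + 1) (by omega)).1
  have hD : ∀ k, d (k + 1) ≤ D := fun k => (hd (k + 1) (by omega)).2.trans hdpD
  have h0 : ∀ k, 0 < d (k + 1) := fun k => hdm.trans_le (hbe k)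
  have hθe : ∀ k, θ ≤ d (k + 1) := fun k => (min_le_left _ _).trans (hbe k)
  have he := abs_le_of_nonneg_of_le (fun k => (h0 k).le) hD
  refine ⟨genCoeff_pos h0 hD, fun z hz => hasSum_genCoeff he hz, fun a g hg n hn => ?_⟩
  have hn0 : (0 : ℝ) < n := by exact_mod_cast hn
  have hr0 := rad_pos n
  have hR := genReal_pos d (rad n)
  simp only [← rad_pow]
  rw [show Real.exp (-1 / (n : ℝ)) = rad n from rfl, genFun_ofReal, Complex.ofReal_re]
  have hsum : Summable fun j : Set.Ioi n => ‖S (genCoeff d) a j‖ / ((j : ℕ) : ℝ) * rad n ^ (j : ℕ) := by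
    have hall : Summable fun j : ℕ => ‖S (genCoeff d) a j‖ / (j : ℝ) * rad n ^ j := by
      refine Summable.of_nonneg_of_le (fun j => by positivity) (fun j => ?_)
        (summable_norm_S he hg hr0.le (rad_lt_one hn))
      refine mul_le_mul_of_nonneg_right ?_ (by positivity)
      rcases Nat.eq_zero_or_pos j with rfl | hj
      · simp
      · exact div_le_self (norm_nonneg _) (by exact_mod_cast hj)
    exact hall.subtype (Set.Ioi n)
  refine ⟨hsum, ?_⟩
  rw [mean_sub_eq h0 hD hg hn]
  have hhead : ‖∑ j ∈ Finset.Icc 1 n, S (genCoeff d) a j *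
      ((meanInt d n j / genCoeff d n - recipInt d n j -
        (if j = n then 1 / (n * genCoeff d n) else 0) : ℝ) : ℂ)‖ ≤
      C * (1 / (n : ℝ) ^ θ * ∑ j ∈ Finset.Icc 1 n,
        ‖S (genCoeff d) a j‖ / genCoeff d j * (j : ℝ) ^ (θ - 2)) := by
    rw [Finset.mul_sum, Finset.mul_sum]
    refine norm_sum_le_of_le _ fun j hj => ?_
    obtain ⟨hj1, hjn⟩ := Finset.mem_Icc.1 hj
    rw [norm_mul, Complex.norm_real, Real.norm_eq_abs]
    refine (mul_le_mul_of_nonneg_left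
      (hweight d θ hθ0 hθ1 hθe hbe hD n j hj1 hjn) (norm_nonneg _)).trans (le_of_eq ?_)
    ring
  have htail : ‖∑' j : Set.Ioi n, S (genCoeff d) a j * (recipInt d n j : ℂ)‖ ≤
      C' * (1 / genReal d (rad n) * ∑' j : Set.Ioi n,
        ‖S (genCoeff d) a j‖ / ((j : ℕ) : ℝ) * rad n ^ (j : ℕ)) := by
    rw [← tsum_mul_left, ← tsum_mul_left]
    refine tsum_of_norm_bounded ((hsum.mul_left _).mul_left _).hasSum fun j => ?_
    rw [norm_mul, Complex.norm_real, Real.norm_of_nonneg (recipInt_nonneg d n j)]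
    refine (mul_le_mul_of_nonneg_left (recipInt_le_of_le (fun k => (h0 k).le) hD hn
      (le_of_lt j.2)) (norm_nonneg _)).trans (le_of_eq ?_)
    rw [hC']
    field_simp
  have hA : 0 ≤ 1 / (n : ℝ) ^ θ * ∑ j ∈ Finset.Icc 1 n,
      ‖S (genCoeff d) a j‖ / genCoeff d j * (j : ℝ) ^ (θ - 2) :=
    mul_nonneg (by positivity) (Finset.sum_nonneg fun j _ =>
      mul_nonneg (div_nonneg (norm_nonneg _) (genCoeff_pos h0 hD j).le) (by positivity))
  have hB : 0 ≤ 1 / genReal d (rad n) * ∑' j : Set.Ioi n,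
      ‖S (genCoeff d) a j‖ / ((j : ℕ) : ℝ) * rad n ^ (j : ℕ) :=
    mul_nonneg (by positivity) (tsum_nonneg fun j => by positivity)
  refine (norm_sub_le _ _).trans ((add_le_add hhead htail).trans ?_)
  have := mul_nonneg hC'0.le hA
  have := mul_nonneg hC.le hB
  linarith
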